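/- **Setting.** An $L$-function here is given by a Dirichlet series $L(s,f)=\sum_{n\ge1}\lambda_f(n)n^{-s}$, not identically zero and absolutely convergent somewhere, which continues to an entire function, together with an integer $q_f\ge 1$ and local parameters $\kappa_1,\dots,\kappa_d\in\mathbb C$ ($d\ge1$) such that, with $L_\infty(s,f)=q_f^{s/2}\prod_{j=1}^d\pi^{-(s+\kappa_j)/2}\Gamma\big(\tfrac{s+\kappa_j}{2}\big)$, the completed function $\Lambda(s,f)=L_\infty(s,f)L(s,f)$ is entire and $\Lambda(s,f)=\varepsilon_f\Lambda(1-s,\bar f)$ with $|\varepsilon_f|=1$; the dual $L(s,\bar f)$ has coefficients $\overline{\lambda_f(n)}$, local parameters $\overline{\kappa_j}$ and the same $q_f$. The analytic conductor is $c_f=q_f\prod_j(|\kappa_j|+3)$. The non-trivial zeros $\rho_f=\frac12+i\gamma_f$ are the zeros of $\Lambda(s,f)$, and GRH means that all $\gamma_f$ are real. Let $\{L(s,f):f\in\mathcal F\}$ be a family of such $L$-functions, closed under $f\mapsto\bar f$, with $L_\infty(s,f)$ finite and non-zero on $\mathrm{Re}\,s=\frac12$. For real $\mathcal Q$ let $\mathcal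 F(\mathcal Q)$ denote $\{f\in\mathcal F: c_f=\mathcal Q\}$ or, alternatively, $\{f\in\mathcal F:c_f\le \mathcal Q\}$ (one of the two, fixed throughout), assumed finite for every $\mathcal Q$; limits as $\mathcal Q\to\infty$ are taken through those $\mathcal Q$ with $\mathcal F(\mathcal Q)\ne\emptyset$. For $G\in\{\mathrm{U},\mathrm{Sp},\mathrm{O},\mathrm{SO(even)},\mathrm{SO(odd)}\}$ let $W_{\mathrm U}(x)=1$, $W_{\mathrm{Sp}}(x)=1-\frac{\sin2\pi x}{2\pi x}$, $W_{\mathrm O}(x)=1+\frac12\boldsymbol\delta_0(x)$, $W_{\mathrm{SO(even)}}(x)=1+\frac{\sin2\pi x}{2\pi x}$, $W_{\mathrm{SO(odd)}}(x)=1-\frac{\sin2\pi x}{2\pi x}+\boldsymbol\delta_0(x)$, where $\boldsymbol\delta_0$ is the Dirac delta at $0$. For $\Delta>0$ let $\mathcal H_{\pi\Delta}$ be the set of entire functions of exponential type at most $\pi\Delta$ whose restriction to $\mathbb R$ is square-integrable, and for $\alpha\in\mathbb R$ put $$\mathbb A(G,\pi\Delta,\alpha)=\inf_{0\ne F\in\mathcal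 H_{\pi\Delta}}\frac{\int_{\mathbb R}|(x-\alpha)F(x)|^2\,W_G(x)\,dx}{\int_{\mathbb R}|F(x)|^2\,W_G(x)\,dx}.$$ **Theorem 1.** Fix a real $\alpha\neq0$ and $\Delta>0$. Assume GRH for the $L$-functions in the family, and assume that for some $G$ as above $$\lim_{\mathcal Q\to\infty}\frac1{|\mathcal F(\mathcal Q)|}\sum_{f\in\mathcal F(\mathcal Q)}\sum_{\gamma_f}\phi\Big(\frac{\gamma_f\log c_f}{2\pi}\Big)=\int_{\mathbb R}\phi(x)\,W_G(x)\,dx$$ for all even Schwartz functions $\phi$ with $\mathrm{supp}\,\widehat\phi\subseteq(-\Delta,\Delta)$, where zeros are counted with multiplicity, the sums over $\gamma_f$ converge absolutely, and $\widehat\phi(\xi)=\int_{\mathbb R}\phi(x)e^{-2\pi ix\xi}\,dx$. Then the minimum below exists for all sufficiently large $\mathcal Q$ with $\mathcal F(\mathcal Q)\neq\emptyset$, and $$\limsup_{\mathcal Q\to\infty}\ \min_{\substack{\gamma_f\\ f\in\mathcal F(\mathcal Q)}}\Big|\frac{\gamma_f\log c_f}{2\pi}-\alpha\Big|\le\sqrt{\mathbb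 A(G,\pi\Delta,\alpha)}.$$ -/

import Mathlib

open Filter Topology MeasureTheory
open scoped ComplexConjugate ENNReal FourierTransform SchwartzMap

noncomputable section

/-- The archimedean factor `L_∞(s) = q^{s/2} ∏_j Γ_ℝ(s + κ_j)`, where `Γ_ℝ(s) = π^{-s/2} Γ(s/2)`.
It has no zeros; with Mathlib's convention for `Γ`, the value `0` is taken exactly at the poles. -/
def archFactor (q : ℕ) (κ : Multiset ℂ) (s : ℂ) : ℂ :=
  (q : ℂ) ^ (s / 2) * (κ.map fun k => Complex.Gammaℝ (s + k)).prod

/-- An entire `L`-function: a Dirichlet series `∑ λ(n) n^{-s}` which converges absolutely somewhere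
and continues to an entire function, whose completion `Λ(s) = L_∞(s) L(s)` is entire and satisfies
`Λ(s) = ε · Λ(1 - s, dual)` with `|ε| = 1`, where `Λ(s, dual)` is the conjugate of `Λ(conj s)`. -/
structure LFunction where
  /-- the Dirichlet coefficients `λ(n)`, `n ≥ 1` -/
  coeff : ℕ → ℂ
  /-- convention for the meaningless index `0` -/
  coeff_zero : coeff 0 = 0
  /-- the `L`-function is not identically zero -/
  coeff_ne_zero : ∃ n, coeff n ≠ 0
  /-- the (arithmetic) conductor `q` -/
  conductor : ℕ
  conductor_pos : 0 < conductor
  /-- the local parameters `κ_j` at infinity; their number is the degree -/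
  kappa : Multiset ℂ
  degree_pos : 0 < kappa.card
  /-- the entire continuation `L(s)` of the Dirichlet series -/
  toFun : ℂ → ℂ
  differentiable_toFun : Differentiable ℂ toFun
  exists_summable : ∃ s, LSeriesSummable coeff s
  toFun_eq : ∀ s, LSeriesSummable coeff s → toFun s = LSeries coeff s
  /-- the completed `L`-function `Λ(s)` -/
  completed : ℂ → ℂ
  differentiable_completed : Differentiable ℂ completed
  completed_eq : ∀ s, archFactor conductor kappa s ≠ 0 →
    completed s = archFactor conductor kappa s * toFun s
  functional_equation : ∃ ε : ℂ, ‖ε‖ = 1 ∧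
    ∀ s, completed s = ε * conj (completed (1 - conj s))

theorem archFactor_conj (q : ℕ) (κ : Multiset ℂ) (s : ℂ) :
    archFactor q (κ.map conj) s = conj (archFactor q κ (conj s)) := by
  have hG : ∀ z : ℂ, Complex.Gammaℝ (conj z) = conj (Complex.Gammaℝ z) := by
    intro z
    have hpi : (Real.pi : ℂ).arg ≠ Real.pi := by
      rw [Complex.arg_ofReal_of_nonneg Real.pi_pos.le]; exact Real.pi_pos.ne
    rw [Complex.Gammaℝ_def, Complex.Gammaℝ_def, map_mul, ← Complex.Gamma_conj]
    have h1 : -conj z / 2 = conj (-z / 2) := by rw [map_div₀, map_neg, map_ofNat]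
    have h2 : conj z / 2 = conj (z / 2) := by rw [map_div₀, map_ofNat]
    rw [h1, h2, Complex.cpow_conj _ _ hpi, Complex.conj_ofReal]
  have hq : (q : ℂ).arg ≠ Real.pi := by
    rw [Complex.natCast_arg]; exact Real.pi_pos.ne
  have h3 : s / 2 = conj (conj s / 2) := by rw [map_div₀, map_ofNat, Complex.conj_conj]
  unfold archFactor
  rw [map_mul, map_multiset_prod, Multiset.map_map, Multiset.map_map]
  congr 1
  · rw [h3, Complex.cpow_conj _ _ hq]; simp
  · congr 1
    refine Multiset.map_congr rfl fun k _ => ?_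
    simp only [Function.comp_apply]
    rw [← hG]; simp

theorem LSeries_term_conj (a : ℕ → ℂ) (s : ℂ) (n : ℕ) :
    LSeries.term (fun n => conj (a n)) s n = conj (LSeries.term a (conj s) n) := by
  have hn : (n : ℂ).arg ≠ Real.pi := by
    rw [Complex.natCast_arg]; exact Real.pi_pos.ne
  rcases eq_or_ne n 0 with rfl | h
  · simp
  · rw [LSeries.term_of_ne_zero h, LSeries.term_of_ne_zero h, map_div₀,
      Complex.cpow_conj _ _ hn]
    simp

theorem LSeriesSummable_conj {a : ℕ → ℂ} {s : ℂ} :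
    LSeriesSummable (fun n => conj (a n)) s ↔ LSeriesSummable a (conj s) := by
  unfold LSeriesSummable
  have : LSeries.term (fun n => conj (a n)) s = fun n => conj (LSeries.term a (conj s) n) :=
    funext (LSeries_term_conj a s)
  rw [this]
  exact Complex.summable_conj

theorem LSeries_conj (a : ℕ → ℂ) (s : ℂ) :
    LSeries (fun n => conj (a n)) s = conj (LSeries a (conj s)) := by
  unfold LSeries
  rw [Complex.conj_tsum]
  exact tsum_congr (LSeries_term_conj a s)

namespace LFunction

/-- The dual `L`-function, with coefficients `conj λ(n)` and local parameters `conj κ_j`. -/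
def dual (f : LFunction) : LFunction where
  coeff n := conj (f.coeff n)
  coeff_zero := by simp [f.coeff_zero]
  coeff_ne_zero := by simpa using f.coeff_ne_zero
  conductor := f.conductor
  conductor_pos := f.conductor_pos
  kappa := f.kappa.map conj
  degree_pos := by simpa using f.degree_pos
  toFun s := conj (f.toFun (conj s))
  differentiable_toFun s := by
    have h := (f.differentiable_toFun (conj s)).conj_conj
    rw [Complex.conj_conj] at h
    exact h
  exists_summable := by
    obtain ⟨s, hs⟩ := f.exists_summable
    exact ⟨conj s, LSeriesSummable_conj.2 (by simpa using hs)⟩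
  toFun_eq s hs := by
    rw [f.toFun_eq _ (LSeriesSummable_conj.1 hs), LSeries_conj]
  completed s := conj (f.completed (conj s))
  differentiable_completed s := by
    have h := (f.differentiable_completed (conj s)).conj_conj
    rw [Complex.conj_conj] at h
    exact h
  completed_eq s hs := by
    rw [archFactor_conj] at hs ⊢
    rw [f.completed_eq (conj s) (by simpa using hs), map_mul]
  functional_equation := by
    obtain ⟨ε, hε, h⟩ := f.functional_equation
    refine ⟨conj ε, by simpa using hε, fun s => ?_⟩
    rw [h (conj s)]
    simp

/-- The functional equation in the form `Λ(s, f) = ε Λ(1 - s, dual of f)`. -/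
theorem functional_equation_dual (f : LFunction) :
    ∃ ε : ℂ, ‖ε‖ = 1 ∧ ∀ s, f.completed s = ε * f.dual.completed (1 - s) := by
  obtain ⟨ε, hε, h⟩ := f.functional_equation
  exact ⟨ε, hε, fun s => by rw [h s]; simp [dual]⟩

/-- The analytic conductor `c = q ∏_j (|κ_j| + 3)`. -/
def analyticConductor (f : LFunction) : ℝ :=
  f.conductor * (f.kappa.map fun k => ‖k‖ + 3).prod

/-- The generalized Riemann hypothesis: every non-trivial zero (that is, every zero of the
completed `L`-function) has real part `1/2`. -/
def GRH (f : LFunction) : Prop :=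
  ∀ s, f.completed s = 0 → s.re = 1 / 2

/-- The ordinates `γ` of the non-trivial zeros `1/2 + iγ` on the critical line. -/
def ordinates (f : LFunction) : Set ℝ :=
  {γ | f.completed (1 / 2 + Complex.I * γ) = 0}

/-- The multiplicity of `1/2 + iγ` as a non-trivial zero. -/
def multiplicity (f : LFunction) (γ : ℝ) : ℕ :=
  analyticOrderNatAt f.completed (1 / 2 + Complex.I * γ)

/-- The normalized ordinate `γ log c / (2π)`. -/
def normalized (f : LFunction) (γ : ℝ) : ℝ :=
  γ * Real.log f.analyticConductor / (2 * Real.pi)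

end LFunction

/-- The two ways of ordering a family by conductor: `c_f = Q` or `c_f ≤ Q`. -/
inductive ConductorOrdering
  | eq
  | le

/-- The standing assumptions on a family `(L(s, f))_f` indexed by `f : ι`: it is closed under duals, and
the archimedean factors do not vanish (nor have poles) on the critical line. -/
structure IsAdmissibleFamily {ι : Type*} (L : ι → LFunction) : Prop where
  dual_mem : ∀ f, ∃ g, L g = (L f).dual
  archFactor_ne_zero : ∀ f, ∀ s : ℂ, s.re = 1 / 2 →
    archFactor (L f).conductor (L f).kappa s ≠ 0

/-- The set `𝓕(Q)`. -/
def familyAt {ι : Type*} (L : ι → LFunction) : ConductorOrdering → ℝ → Set ι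
  | .eq, Q => {f | (L f).analyticConductor = Q}
  | .le, Q => {f | (L f).analyticConductor ≤ Q}

/-- `Q → ∞` through the values for which `𝓕(Q)` is non-empty. -/
def conductorFilter {ι : Type*} (L : ι → LFunction) (o : ConductorOrdering) : Filter ℝ :=
  atTop ⊓ 𝓟 {Q | (familyAt L o Q).Nonempty}

/-- The five symmetry groups. -/
inductive SymmetryGroup
  | U
  | Sp
  | O
  | SOeven
  | SOodd

namespace SymmetryGroup

/-- The coefficient of `sin (2πx) / (2πx)` in the density `W_G`. -/
def sincCoeff : SymmetryGroup → ℝ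
  | U => 0
  | Sp => -1
  | O => 0
  | SOeven => 1
  | SOodd => -1

/-- The coefficient of the Dirac delta at `0` in the density `W_G`. -/
def deltaCoeff : SymmetryGroup → ℝ
  | U => 0
  | Sp => 0
  | O => 1 / 2
  | SOeven => 0
  | SOodd => 1

/-- The measure `W_G(x) dx`, where
`W_G(x) = 1 + sincCoeff · sin (2πx) / (2πx) + deltaCoeff · δ₀(x)`. -/
def density (G : SymmetryGroup) : Measure ℝ :=
  volume.withDensity
      (fun x => ENNReal.ofReal (1 + G.sincCoeff * Real.sinc (2 * Real.pi * x))) +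
    ENNReal.ofReal G.deltaCoeff • Measure.dirac 0

end SymmetryGroup

/-- The one-level density of the family (with zeros counted with multiplicity) is given by `W_G`
for all even Schwartz functions `φ` whose Fourier transform `∫ φ(x) e^{-2πixξ} dx` is supported in
`(-Δ, Δ)`; the sums over zeros are understood to converge absolutely. -/
def HasOneLevelDensity {ι : Type*} (L : ι → LFunction) (o : ConductorOrdering)
    (G : SymmetryGroup) (Δ : ℝ) : Prop :=
  ∀ φ : 𝓢(ℝ, ℝ), (∀ x, φ (-x) = φ x) →
    tsupport (𝓕 fun x : ℝ => (φ x : ℂ)) ⊆ Set.Ioo (-Δ) Δ →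
    (∀ f, Summable fun γ : (L f).ordinates =>
      ((L f).multiplicity γ : ℝ) * φ ((L f).normalized γ)) ∧
    Tendsto (fun Q => (∑ᶠ f ∈ familyAt L o Q, ∑' γ : (L f).ordinates,
        ((L f).multiplicity γ : ℝ) * φ ((L f).normalized γ)) / (familyAt L o Q).ncard)
      (conductorFilter L o) (𝓝 (∫ x, φ x ∂G.density))

/-- The exponential type `limsup_{|z| → ∞} |z|⁻¹ log |F(z)|` of an entire function. -/
def exponentialType (F : ℂ → ℂ) : EReal :=
  limsup (fun z : ℂ => ENNReal.log ‖F z‖ₑ / ((‖z‖ : ℝ) : EReal)) (cocompact ℂ)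

/-- The set `𝓗_τ` of entire functions of exponential type at most `τ` whose restriction to `ℝ` is
square-integrable. -/
def paleyWienerSet (τ : ℝ) : Set (ℂ → ℂ) :=
  {F | Differentiable ℂ F ∧ exponentialType F ≤ (τ : EReal) ∧
    MemLp (fun x : ℝ => F x) 2 volume}

/-- The sharp constant `𝔸(G, τ, α)`: the infimum over `0 ≠ F ∈ 𝓗_τ` of
`∫ |(x - α) F(x)|² W_G(x) dx / ∫ |F(x)|² W_G(x) dx`. -/
def sharpConstant (G : SymmetryGroup) (τ α : ℝ) : ℝ≥0∞ :=
  ⨅ F ∈ {F | F ∈ paleyWienerSet τ ∧ F ≠ 0},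
    (∫⁻ x : ℝ, ‖((x : ℂ) - α) * F x‖ₑ ^ 2 ∂G.density) / ∫⁻ x : ℝ, ‖F x‖ₑ ^ 2 ∂G.density

/-- The distances `|γ_f log c_f / (2π) - α|`, for `f ∈ 𝓕(Q)` and non-trivial zeros `1/2 + iγ_f`. -/
def zeroDistances {ι : Type*} (L : ι → LFunction) (o : ConductorOrdering) (α Q : ℝ) : Set ℝ :=
  {d | ∃ f ∈ familyAt L o Q, ∃ γ ∈ (L f).ordinates, d = |(L f).normalized γ - α|}

end

/-! Suppose `F` has type `πΔ` and quotient below `s²`. Then `p(x) = ((x - α)² - s²)|F(x)|²` has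
negative integral against `W_G`, is non-negative where `|x - α| ≥ s`, and extends to an entire
function of type `2πΔ`, so its Fourier transform lives on `[-Δ, Δ]`. Its symmetrization `φ(x) = p(x)
+ p(-x)` is even, and as `W_G` is even the integral only doubles. The one-level density then makes
the average of `φ` over zeros negative for large `Q`, so some normalized zero has `φ < 0` and lies
within `s` of `α` or `-α`; in the second case the dual `L`-function has a zero within `s` of `α`.
Letting `s²` decrease to the infimum gives the bound.

The obstacle is that `φ` must be Schwartz with Fourier support in the open interval. So `F(x)` is
replaced by `F(rx) η(εx)` with `r < 1`, `ε` of size `1 - r`, and `η` entire and rapidly decaying on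
the line (`exists_rapidly_decaying_entire`); as `r → 1` the integral stays negative by dominated
convergence (`exists_test_function`). The Fourier support comes from Phragmén–Lindelöf and a contour
shift (`fourier_eq_zero_of_lt_neg`). The minimum exists because zeros are discrete and a crude
choice of `F` already produces one. -/

noncomputable section

/-! ### Functions of exponential type -/

/-- `F` satisfies `F(z) = O(e^{b|z|})` for every `b > a`. -/
def HasExpType (F : ℂ → ℂ) (a : ℝ) : Prop :=
  ∀ b > a, ∃ C, ∀ z, ‖F z‖ ≤ C * Real.exp (b * ‖z‖)

namespace HasExpType

variable {F G : ℂ → ℂ} {a b : ℝ}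

theorem mono (hF : HasExpType F a) (h : a ≤ b) : HasExpType F b :=
  fun c hc => hF c (lt_of_le_of_lt h hc)

theorem exists_nonneg (hF : HasExpType F a) (h : a < b) :
    ∃ C, 0 ≤ C ∧ ∀ z, ‖F z‖ ≤ C * Real.exp (b * ‖z‖) := by
  obtain ⟨C, hC⟩ := hF b h
  refine ⟨C, ?_, hC⟩
  have := (norm_nonneg _).trans (hC 0)
  simpa using this

theorem mul (hF : HasExpType F a) (hG : HasExpType G b) :
    HasExpType (fun z => F z * G z) (a + b) := by
  intro c hc
  obtain ⟨C, hC0, hC⟩ := hF.exists_nonneg (b := a + (c - a - b) / 2) (by linarith)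
  obtain ⟨D, hD0, hD⟩ := hG.exists_nonneg (b := b + (c - a - b) / 2) (by linarith)
  refine ⟨C * D, fun z => ?_⟩
  rw [norm_mul]
  calc ‖F z‖ * ‖G z‖ ≤ _ := mul_le_mul (hC z) (hD z) (norm_nonneg _) (by positivity)
    _ = C * D * (Real.exp ((a + (c - a - b) / 2) * ‖z‖) *
          Real.exp ((b + (c - a - b) / 2) * ‖z‖)) := by ring
    _ = _ := by rw [← Real.exp_add]; ring_nf

theorem add (hF : HasExpType F a) (hG : HasExpType G a) :
    HasExpType (fun z => F z + G z) a := by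
  intro c hc
  obtain ⟨C, hC⟩ := hF c hc
  obtain ⟨D, hD⟩ := hG c hc
  refine ⟨C + D, fun z => (norm_add_le _ _).trans ?_⟩
  rw [add_mul]
  exact add_le_add (hC z) (hD z)

theorem const (w : ℂ) : HasExpType (fun _ => w) 0 := by
  intro b hb
  refine ⟨‖w‖, fun z => le_mul_of_one_le_right (norm_nonneg _) ?_⟩
  exact Real.one_le_exp (by positivity)

theorem id : HasExpType (fun z => z) 0 := by
  intro b hb
  refine ⟨b⁻¹, fun z => ?_⟩
  rw [inv_mul_eq_div, le_div_iff₀ hb]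
  linarith [Real.add_one_le_exp (b * ‖z‖)]

theorem comp_mul (hF : HasExpType F a) {r : ℝ} (hr : 0 < r) :
    HasExpType (fun z => F (r * z)) (r * a) := by
  intro b hb
  obtain ⟨C, hC⟩ := hF (b / r) (by rw [gt_iff_lt, lt_div_iff₀ hr]; linarith)
  refine ⟨C, fun z => (hC _).trans_eq ?_⟩
  rw [norm_mul, Complex.norm_real, Real.norm_of_nonneg hr.le]
  field_simp

theorem comp_neg (hF : HasExpType F a) : HasExpType (fun z => F (-z)) a := by
  intro b hb
  obtain ⟨C, hC⟩ := hF b hb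
  exact ⟨C, fun z => by simpa using hC (-z)⟩

theorem conj_conj (hF : HasExpType F a) : HasExpType (fun z => conj (F (conj z))) a := by
  intro b hb
  obtain ⟨C, hC⟩ := hF b hb
  exact ⟨C, fun z => by simpa using hC (conj z)⟩

end HasExpType

/-- The limsup controls `F` outside a compact set; continuity supplies the constant inside it. -/
theorem hasExpType_of_exponentialType_le {F : ℂ → ℂ} (hF : Continuous F) {a : ℝ}
    (h : exponentialType F ≤ (a : EReal)) : HasExpType F a := by
  intro b hb
  have h1 : ∀ᶠ z in cocompact ℂ,
      ENNReal.log ‖F z‖ₑ / ((‖z‖ : ℝ) : EReal) < (b : EReal) :=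
    eventually_lt_of_limsup_lt (lt_of_le_of_lt h (by exact_mod_cast hb))
  have h2 : ∀ᶠ z in cocompact ℂ, ‖F z‖ ≤ Real.exp (b * ‖z‖) := by
    have h0 : ∀ᶠ z in cocompact ℂ, (1 : ℝ) ≤ ‖z‖ :=
      (tendsto_norm_cocompact_atTop (E := ℂ)).eventually_ge_atTop 1
    filter_upwards [h1, h0] with z hz hz0
    have hz1 : (0 : ℝ) < ‖z‖ := by linarith
    rw [EReal.div_lt_iff (by exact_mod_cast hz1) (EReal.coe_ne_top _), ← EReal.coe_mul] at hz
    have h3 := EReal.exp_monotone hz.le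
    rw [ENNReal.exp_log, EReal.exp_coe, ← ofReal_norm] at h3
    exact (ENNReal.ofReal_le_ofReal_iff (Real.exp_pos _).le).1 h3
  rw [Filter.Eventually, Filter.mem_cocompact] at h2
  obtain ⟨K, hK, hKs⟩ := h2
  obtain ⟨M, hM⟩ := hK.exists_bound_of_continuousOn
    (f := fun z => F z * (Real.exp (-(b * ‖z‖)) : ℂ)) (by fun_prop)
  refine ⟨max M 1, fun z => ?_⟩
  by_cases hz : z ∈ K
  · have h4 := hM z hz
    rw [norm_mul, Complex.norm_real, Real.norm_of_nonneg (Real.exp_pos _).le, Real.exp_neg,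
      ← div_eq_mul_inv, div_le_iff₀ (Real.exp_pos _)] at h4
    exact h4.trans (by gcongr; exact le_max_left _ _)
  · have h4 : ‖F z‖ ≤ Real.exp (b * ‖z‖) := hKs hz
    exact h4.trans (le_mul_of_one_le_left (Real.exp_pos _).le (le_max_right _ _))

/-! ### Phragmén–Lindelöf bounds and growth on the real line -/

/-- Phragmén–Lindelöf in the upper half-plane for functions of exponential type. -/
theorem norm_le_of_bounded_on_real {H : ℂ → ℂ} (hd : DiffContOnCl ℂ H {z | 0 < z.im})
    {C M b : ℝ} (hb : 0 ≤ b) (hexp : ∀ z : ℂ, 0 ≤ z.im → ‖H z‖ ≤ C * Real.exp (b * ‖z‖))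
    (hM : ∀ x : ℝ, ‖H x‖ ≤ M) {z : ℂ} (hz : 0 ≤ z.im) :
    ‖H z‖ ≤ M * Real.exp (b * z.im) := by
  have hnorm : ∀ w : ℂ, ‖Complex.exp (-(b * w))‖ = Real.exp (-(b * w.re)) := by
    intro w; rw [Complex.norm_exp]; simp
  have hC : 0 ≤ C := by
    have := (norm_nonneg _).trans (hexp 0 (by simp))
    simpa using this
  -- Rotate to the right half-plane. The factor `exp (-(b * w))` cancels the growth along the
  -- positive axis and has modulus 1 on the imaginary axis.
  have key := PhragmenLindelof.right_half_plane_of_bounded_on_real (C := M)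
    (f := fun w => H (Complex.I * w) * Complex.exp (-(b * w))) (z := -Complex.I * z)
    ?_ ?_ ?_ ?_ (by simpa using hz)
  · have e : Complex.I * (-Complex.I * z) = z := by
      rw [← mul_assoc]; simp
    rw [e, norm_mul, hnorm] at key
    have e2 : (-Complex.I * z).re = z.im := by simp
    rw [e2, Real.exp_neg, ← div_eq_mul_inv, div_le_iff₀ (Real.exp_pos _)] at key
    exact key
  · have h1 : DiffContOnCl ℂ (fun w => H (Complex.I * w)) {w : ℂ | 0 < w.re} := by
      refine hd.comp (g := fun w => Complex.I * w) (Differentiable.diffContOnCl (by fun_prop)) ?_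
      intro w hw
      simpa using hw
    exact h1.smul (Differentiable.diffContOnCl (f := fun w : ℂ => Complex.exp (-(b * w)))
      (by fun_prop))
  · refine ⟨1, by norm_num, b, Asymptotics.IsBigO.of_bound C ?_⟩
    refine eventually_inf_principal.2 (Eventually.of_forall fun w hw => ?_)
    have hw : 0 < w.re := hw
    rw [norm_mul, hnorm, Real.rpow_one, Real.norm_of_nonneg (Real.exp_pos _).le]
    have h1 := hexp (Complex.I * w) (by simpa using hw.le)
    rw [norm_mul, Complex.norm_I, one_mul] at h1
    refine (mul_le_of_le_one_right (norm_nonneg _) ?_).trans h1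
    exact Real.exp_le_one_iff.2 (by nlinarith)
  · refine isBoundedUnder_of_eventually_le (a := C) ?_
    filter_upwards [eventually_ge_atTop 0] with x hx
    have h1 := hexp (Complex.I * x) (by simpa using hx)
    rw [norm_mul, Complex.norm_I, one_mul, Complex.norm_real, Real.norm_of_nonneg hx] at h1
    rw [norm_mul, hnorm, Complex.ofReal_re, Real.exp_neg, ← div_eq_mul_inv,
      div_le_iff₀ (Real.exp_pos _)]
    exact h1
  · intro x
    have e : Complex.I * (x * Complex.I) = ((-x : ℝ) : ℂ) := by
      push_cast; linear_combination (x : ℂ) * Complex.I_mul_I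
    rw [e, norm_mul, hnorm]
    simpa using hM (-x)

/-- A function of exponential type which is `O((1 + |x|))` on the real line is
`O((1 + |z|) e^{b |Im z|})`. -/
theorem HasExpType.norm_le_of_linear_growth {P : ℂ → ℂ} (hP : Differentiable ℂ P) {a b : ℝ}
    (ha : HasExpType P a) (hab : a < b) (hb : 0 ≤ b) {M : ℝ}
    (hM : ∀ x : ℝ, ‖P x‖ ≤ M * (1 + |x|)) (z : ℂ) :
    ‖P z‖ ≤ 2 * M * (1 + ‖z‖) * Real.exp (b * |z.im|) := by
  have upper : ∀ Q : ℂ → ℂ, Differentiable ℂ Q → HasExpType Q a →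
      (∀ x : ℝ, ‖Q x‖ ≤ M * (1 + |x|)) → ∀ z : ℂ, 0 ≤ z.im →
      ‖Q z‖ ≤ 2 * M * (1 + ‖z‖) * Real.exp (b * z.im) := by
    intro Q hQ hQa hQM z hz
    have him : ∀ w : ℂ, 0 ≤ w.im → 1 ≤ ‖w + Complex.I‖ := by
      intro w hw
      have := Complex.abs_im_le_norm (w + Complex.I)
      simp only [Complex.add_im, Complex.I_im] at this
      rw [abs_of_nonneg (by linarith)] at this
      linarith
    obtain ⟨C, hC0, hC⟩ := hQa.exists_nonneg hab
    have hM0 : 0 ≤ M := by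
      have := (norm_nonneg _).trans (hQM 0)
      simpa using this
    -- Dividing by `w + I`, of modulus at least 1 in the closed upper half-plane, removes the linear
    -- growth; the 2 comes from `1 + |x| ≤ 2 |x + I|`.
    have h := norm_le_of_bounded_on_real (H := fun w => Q w / (w + Complex.I)) (C := C)
      (M := 2 * M) (b := b) ?_ hb ?_ ?_ hz
    · rw [norm_div, div_le_iff₀ (by linarith [him z hz])] at h
      refine h.trans ?_
      have : ‖z + Complex.I‖ ≤ 1 + ‖z‖ := by
        refine (norm_add_le _ _).trans ?_
        rw [Complex.norm_I]; linarith
      calc 2 * M * Real.exp (b * z.im) * ‖z + Complex.I‖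
          ≤ 2 * M * Real.exp (b * z.im) * (1 + ‖z‖) := by gcongr
        _ = _ := by ring
    · refine DifferentiableOn.diffContOnCl fun w hw => ?_
      have hcl : w ∈ {z : ℂ | 0 ≤ z.im} :=
        closure_minimal (s := {z : ℂ | 0 < z.im}) (fun z hz => le_of_lt hz)
          (isClosed_le continuous_const Complex.continuous_im) hw
      have hne : w + Complex.I ≠ 0 := by
        intro h0
        have := him w hcl
        rw [h0, norm_zero] at this
        linarith
      exact ((hQ w).div (by fun_prop) hne).differentiableWithinAt
    · intro w hw
      rw [norm_div]
      exact (div_le_self (norm_nonneg _) (him w hw)).trans (hC w)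
    · intro x
      have h1 := him x (by simp)
      rw [norm_div, div_le_iff₀ (by linarith)]
      refine (hQM x).trans ?_
      have h2 := Complex.abs_re_le_norm ((x : ℂ) + Complex.I)
      simp only [Complex.add_re, Complex.ofReal_re, Complex.I_re, add_zero] at h2
      nlinarith
  rcases le_total 0 z.im with hz | hz
  · rw [abs_of_nonneg hz]
    exact upper P hP ha hM z hz
  · rw [abs_of_nonpos hz]
    have := upper (fun w => P (-w)) (by fun_prop) ha.comp_neg
      (fun x => by simpa using hM (-x)) (-z) (by simpa using hz)
    simpa using this

/-- The mean value inequality costs a factor `‖z‖`, which half of the slack `b - a` absorbs. -/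
theorem HasExpType.primitive {F P : ℂ → ℂ} {a : ℝ} (ha0 : 0 ≤ a) (ha : HasExpType F a)
    (hP : ∀ z, HasDerivAt P (F z) z) (hP0 : P 0 = 0) : HasExpType P a := by
  intro b hb
  obtain ⟨C, hC0, hC⟩ := ha.exists_nonneg (b := (a + b) / 2) (by linarith)
  obtain ⟨D, hD0, hD⟩ := HasExpType.id.exists_nonneg (b := (b - a) / 2) (by linarith)
  refine ⟨C * D, fun z => ?_⟩
  have h := Convex.norm_image_sub_le_of_norm_hasDerivWithin_le (𝕜 := ℂ) (f := P) (f' := F)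
    (s := Metric.closedBall 0 ‖z‖) (x := 0) (y := z) (C := C * Real.exp ((a + b) / 2 * ‖z‖))
    (fun w _ => (hP w).hasDerivWithinAt) (fun w hw => ?_) (convex_closedBall _ _) (by simp)
    (by simp)
  · rw [hP0, sub_zero, sub_zero] at h
    refine h.trans ?_
    calc C * Real.exp ((a + b) / 2 * ‖z‖) * ‖z‖
        ≤ C * Real.exp ((a + b) / 2 * ‖z‖) * (D * Real.exp ((b - a) / 2 * ‖z‖)) := by
          gcongr; exact hD z
      _ = C * D * (Real.exp ((a + b) / 2 * ‖z‖) * Real.exp ((b - a) / 2 * ‖z‖)) := by ring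
      _ = _ := by rw [← Real.exp_add]; ring_nf
  · refine (hC w).trans ?_
    have : ‖w‖ ≤ ‖z‖ := by simpa using hw
    have h2 : 0 ≤ (a + b) / 2 := by linarith
    gcongr

/-- A square-integrable function of exponential type grows at most linearly on the real line. -/
theorem HasExpType.exists_norm_le_linear {F : ℂ → ℂ} (hF : Differentiable ℂ F) {a : ℝ}
    (ha0 : 0 ≤ a) (ha : HasExpType F a) (hL2 : MemLp (fun x : ℝ => F x) 2 volume) :
    ∃ M, ∀ x : ℝ, ‖F x‖ ≤ M * (1 + |x|) := by
  -- A primitive `P` grows linearly on the line, since `‖F‖ ≤ 1 + ‖F‖²`. Phragmén–Lindelöf carries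
  -- this to the strip `|Im z| ≤ 1`, and Cauchy's estimate on unit circles returns to `F = P'`.
  obtain ⟨P, hP0, hP⟩ := hF.isExactOn_univ.with_val_at 0 0
  have hP' : ∀ z, HasDerivAt P (F z) z := fun z => hP z (Set.mem_univ z)
  have hint : Integrable (fun x : ℝ => ‖F x‖ ^ 2) := hL2.integrable_norm_pow (by norm_num)
  set S : ℝ := ∫ x : ℝ, ‖F x‖ ^ 2 with hS
  have hc : Continuous fun x : ℝ => F x := hF.continuous.comp Complex.continuous_ofReal
  have hPM : ∀ x : ℝ, ‖P x‖ ≤ (1 + S) * (1 + |x|) := by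
    intro x
    have h1 : ∫ t in (0 : ℝ)..x, F t = P x - P 0 := by
      have := intervalIntegral.integral_eq_sub_of_hasDerivAt (a := 0) (b := x)
        (f := fun t : ℝ => P t) (f' := fun t : ℝ => F t)
        (fun t _ => (hP' t).comp_ofReal) (hc.intervalIntegrable _ _)
      simpa using this
    rw [hP0, sub_zero] at h1
    rw [← h1]
    have hS0 : 0 ≤ S := integral_nonneg fun x => by positivity
    have : IsFiniteMeasure (volume.restrict (Set.uIoc 0 x)) := by
      unfold Set.uIoc; infer_instance
    calc ‖∫ t in (0 : ℝ)..x, F t‖ ≤ ∫ t in Set.uIoc 0 x, ‖F t‖ :=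
          intervalIntegral.norm_integral_le_integral_norm_uIoc
      _ ≤ ∫ t in Set.uIoc 0 x, (1 + ‖F t‖ ^ 2) := by
          refine integral_mono_of_nonneg (Eventually.of_forall fun t => norm_nonneg _)
            ((integrable_const _).add hint.integrableOn) (Eventually.of_forall fun t => ?_)
          show ‖F t‖ ≤ 1 + ‖F t‖ ^ 2
          nlinarith [sq_nonneg (‖F t‖ - 1)]
      _ = |x| + ∫ t in Set.uIoc 0 x, ‖F t‖ ^ 2 := by
          rw [integral_add (integrable_const _) hint.integrableOn]
          simp [Set.uIoc, Measure.real]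
          rcases le_total 0 x with h | h <;> simp [h, abs_of_nonneg, abs_of_nonpos]
      _ ≤ |x| + S := by
          gcongr
          exact setIntegral_le_integral hint (Eventually.of_forall fun t => by positivity)
      _ ≤ _ := by nlinarith [abs_nonneg x]
  have hPd : Differentiable ℂ P := fun z => (hP' z).differentiableAt
  have hb := (ha.primitive ha0 hP' hP0).norm_le_of_linear_growth hPd (b := a + 1)
    (by linarith) (by linarith) hPM
  have hS0 : 0 ≤ S := integral_nonneg fun x => by positivity
  refine ⟨2 * (1 + S) * 2 * Real.exp (a + 1), fun x => ?_⟩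
  rw [← (hP' x).deriv]
  have := Complex.norm_deriv_le_of_forall_mem_sphere_norm_le (c := (x : ℂ)) (R := 1) (f := P)
    (C := 2 * (1 + S) * 2 * Real.exp (a + 1) * (1 + |x|)) one_pos hPd.diffContOnCl ?_
  · simpa using this
  · intro z hz
    rw [mem_sphere_iff_norm] at hz
    have h1 : ‖z‖ ≤ 1 + |x| := by
      have := norm_add_le (z - x) (x : ℂ)
      rw [hz, Complex.norm_real, sub_add_cancel] at this
      exact this
    have h2 : |z.im| ≤ 1 := by
      have := Complex.abs_im_le_norm (z - x)
      rw [hz] at this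
      simpa using this
    refine (hb z).trans ?_
    have h3 : 1 + ‖z‖ ≤ 2 * (1 + |x|) := by linarith [abs_nonneg x]
    have h4 : (a + 1) * |z.im| ≤ a + 1 := mul_le_of_le_one_right (by linarith) h2
    calc _ ≤ 2 * (1 + S) * (2 * (1 + |x|)) * Real.exp (a + 1) := by gcongr
      _ = _ := by ring

/-! ### Rapid decay -/

/-- `f` decays on the real line faster than every power of `|x|`. -/
def HasRapidDecay (f : ℝ → ℂ) : Prop :=
  ∀ k : ℕ, ∃ C, ∀ x, |x| ^ k * ‖f x‖ ≤ C

namespace HasRapidDecay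

variable {f g : ℝ → ℂ}

theorem add (hf : HasRapidDecay f) (hg : HasRapidDecay g) :
    HasRapidDecay (fun x => f x + g x) := by
  intro k
  obtain ⟨C, hC⟩ := hf k
  obtain ⟨D, hD⟩ := hg k
  refine ⟨C + D, fun x => ?_⟩
  calc |x| ^ k * ‖f x + g x‖ ≤ |x| ^ k * (‖f x‖ + ‖g x‖) := by gcongr; exact norm_add_le _ _
    _ ≤ C + D := by rw [mul_add]; exact add_le_add (hC x) (hD x)

theorem comp_neg (hf : HasRapidDecay f) : HasRapidDecay (fun x => f (-x)) := by
  intro k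
  obtain ⟨C, hC⟩ := hf k
  exact ⟨C, fun x => by simpa using hC (-x)⟩

theorem comp_mul (hf : HasRapidDecay f) {r : ℝ} (hr : 0 < r) :
    HasRapidDecay (fun x => f (r * x)) := by
  intro k
  obtain ⟨C, hC⟩ := hf k
  refine ⟨C / r ^ k, fun x => ?_⟩
  have := hC (r * x)
  rw [abs_mul, abs_of_pos hr, mul_pow] at this
  rw [le_div_iff₀ (by positivity)]
  linarith

theorem mul_of_linear_growth (hf : HasRapidDecay f) {M : ℝ} (hg : ∀ x, ‖g x‖ ≤ M * (1 + |x|)) :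
    HasRapidDecay (fun x => g x * f x) := by
  intro k
  obtain ⟨C, hC⟩ := hf k
  obtain ⟨D, hD⟩ := hf (k + 1)
  have hM0 : 0 ≤ M := by
    have := (norm_nonneg _).trans (hg 0)
    simpa using this
  refine ⟨M * (C + D), fun x => ?_⟩
  rw [norm_mul]
  calc |x| ^ k * (‖g x‖ * ‖f x‖) ≤ |x| ^ k * (M * (1 + |x|) * ‖f x‖) := by gcongr; exact hg x
    _ = M * (|x| ^ k * ‖f x‖ + |x| ^ (k + 1) * ‖f x‖) := by ring
    _ ≤ _ := by gcongr; exacts [hC x, hD x]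

theorem exists_one_add_sq_mul_le (hf : HasRapidDecay f) (k : ℕ) :
    ∃ M, ∀ x, (1 + x ^ 2) * (|x| ^ k * ‖f x‖) ≤ M := by
  obtain ⟨C, hC⟩ := hf k
  obtain ⟨D, hD⟩ := hf (k + 2)
  refine ⟨C + D, fun x => ?_⟩
  calc _ = |x| ^ k * ‖f x‖ + |x| ^ (k + 2) * ‖f x‖ := by rw [← sq_abs x]; ring
    _ ≤ _ := add_le_add (hC x) (hD x)

theorem integrable_pow_mul (hf : HasRapidDecay f) (hc : Continuous f) (k : ℕ) :
    Integrable fun x : ℝ => ‖x‖ ^ k * ‖f x‖ := by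
  obtain ⟨M, hM⟩ := hf.exists_one_add_sq_mul_le k
  refine (integrable_inv_one_add_sq.const_mul M).mono' (by fun_prop)
    (Eventually.of_forall fun x => ?_)
  rw [Real.norm_of_nonneg (by positivity), ← div_eq_mul_inv, le_div_iff₀ (by positivity), mul_comm]
  exact hM x

theorem integrable (hf : HasRapidDecay f) (hc : Continuous f) : Integrable f := by
  have := hf.integrable_pow_mul hc 0
  simp only [pow_zero, one_mul] at this
  exact (integrable_norm_iff hc.aestronglyMeasurable).1 this

end HasRapidDecay

/-! ### Fourier support of entire functions -/

/-- The Fourier transform of an integrable entire function of exponential type `2πa` vanishes to the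
left of `-a`. -/
theorem fourier_eq_zero_of_lt_neg {Φ : ℂ → ℂ} (hΦ : Differentiable ℂ Φ) {a : ℝ} (ha : 0 ≤ a)
    (hexp : HasExpType Φ (2 * Real.pi * a)) {M : ℝ} (hM : ∀ x : ℝ, (1 + x ^ 2) * ‖Φ x‖ ≤ M)
    {ξ : ℝ} (hξ : ξ < -a) : 𝓕 (fun x : ℝ => Φ x) ξ = 0 := by
  have hpi := Real.pi_pos
  have hM0 : 0 ≤ M := le_trans (by positivity) (hM 0)
  -- The midpoint of `2πa` and `-2πξ`: above the type of `Φ`, yet beaten by the decay of the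
  -- exponential kernel in the upper half-plane.
  set b : ℝ := Real.pi * (a - ξ) with hb
  have hb0 : 0 ≤ b := by apply mul_nonneg hpi.le; linarith
  have hab : 2 * Real.pi * a < b := by rw [hb]; nlinarith
  have hbξ : b + 2 * Real.pi * ξ ≤ 0 := by rw [hb]; nlinarith
  -- The factor `(z + I)²` has modulus `1 + x²` on the line and no zeros above it, so quadratic
  -- decay passes from the line to the half-plane.
  have hH : HasExpType (fun z => (z + Complex.I) * ((z + Complex.I) * Φ z)) (2 * Real.pi * a) := by
    have h1 : HasExpType (fun z => z + Complex.I) 0 := HasExpType.id.add (HasExpType.const _)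
    simpa using h1.mul (h1.mul hexp)
  obtain ⟨C, hC⟩ := hH b hab
  have hIx : ∀ x : ℝ, ‖(x : ℂ) + Complex.I‖ ^ 2 = 1 + x ^ 2 := by
    intro x
    rw [Complex.sq_norm, Complex.normSq_apply]
    simp; ring
  have hup : ∀ z : ℂ, 0 ≤ z.im →
      ‖(z + Complex.I) * ((z + Complex.I) * Φ z)‖ ≤ M * Real.exp (b * z.im) := by
    intro z hz
    refine norm_le_of_bounded_on_real
      (H := fun z => (z + Complex.I) * ((z + Complex.I) * Φ z)) (Differentiable.diffContOnCl
      (by fun_prop)) hb0 (fun z _ => hC z) (fun x => ?_) hz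
    rw [norm_mul, norm_mul, ← mul_assoc, ← sq, hIx]
    exact hM x
  set h : ℂ → ℂ := fun z => Complex.exp (-(2 * Real.pi * ξ * Complex.I) * z) * Φ z with hh
  have hhd : Differentiable ℂ h := by
    have : Differentiable ℂ fun z : ℂ => Complex.exp (-(2 * Real.pi * ξ * Complex.I) * z) := by
      fun_prop
    exact this.mul hΦ
  have hhn : ∀ z : ℂ, ‖h z‖ = Real.exp (2 * Real.pi * ξ * z.im) * ‖Φ z‖ := by
    intro z
    rw [hh, norm_mul, Complex.norm_exp]
    congr 2
    simp [Complex.mul_re, Complex.mul_im]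
  have hbound : ∀ z : ℂ, 0 ≤ z.im → ‖z + Complex.I‖ ^ 2 * ‖h z‖ ≤ M := by
    intro z hz
    have h1 := hup z hz
    rw [norm_mul, norm_mul, ← mul_assoc, ← sq] at h1
    rw [hhn]
    calc ‖z + Complex.I‖ ^ 2 * (Real.exp (2 * Real.pi * ξ * z.im) * ‖Φ z‖)
        = Real.exp (2 * Real.pi * ξ * z.im) * (‖z + Complex.I‖ ^ 2 * ‖Φ z‖) := by ring
      _ ≤ Real.exp (2 * Real.pi * ξ * z.im) * (M * Real.exp (b * z.im)) := by gcongr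
      _ = M * Real.exp ((b + 2 * Real.pi * ξ) * z.im) := by
          rw [mul_left_comm, ← Real.exp_add]; ring_nf
      _ ≤ M := mul_le_of_le_one_right hM0
          (Real.exp_le_one_iff.2 (mul_nonpos_of_nonpos_of_nonneg hbξ hz))
  have hcR : Continuous fun x : ℝ => h x := hhd.continuous.comp Complex.continuous_ofReal
  have hint : Integrable fun x : ℝ => h x := by
    refine (integrable_inv_one_add_sq.const_mul M).mono' hcR.aestronglyMeasurable
      (Eventually.of_forall fun x => ?_)
    have := hbound x (by simp)
    rw [hIx] at this
    rw [← div_eq_mul_inv, le_div_iff₀ (by positivity), mul_comm]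
    exact this
  have hsmall : ∀ T : ℝ, 0 < T → ∀ z : ℂ, 0 ≤ z.im → T ≤ ‖z + Complex.I‖ →
      ‖h z‖ ≤ M / T ^ 2 := by
    intro T hT z hz hTz
    rw [le_div_iff₀ (by positivity), mul_comm]
    refine le_trans ?_ (hbound z hz)
    gcongr
  -- Cauchy's theorem on the rectangle over `[-T, T]` of height `T`: the other sides have total
  -- length `4T`, and `h` is at most `M / T²` there.
  have hlim : Tendsto (fun T : ℝ => ∫ x in (-T)..T, h x) atTop (𝓝 0) := by
    have hz0 : Tendsto (fun T : ℝ => 4 * M / T) atTop (𝓝 0) :=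
      tendsto_const_nhds.div_atTop tendsto_id
    refine squeeze_zero_norm' ?_ hz0
    filter_upwards [eventually_gt_atTop 0] with T hT
    have hrect := Complex.integral_boundary_rect_eq_zero_of_differentiableOn h (-T : ℂ)
      (T + T * Complex.I) hhd.differentiableOn
    simp only [Complex.neg_re, Complex.neg_im, Complex.ofReal_re, Complex.ofReal_im, neg_zero,
      Complex.add_re, Complex.add_im, Complex.mul_re, Complex.mul_im, Complex.I_re, Complex.I_im,
      mul_zero, mul_one, zero_mul, sub_zero, add_zero, zero_add, Complex.ofReal_zero,
      smul_eq_mul] at hrect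
    have hre : ∀ z : ℂ, |z.re| ≤ ‖z + Complex.I‖ := fun z => by
      simpa using Complex.abs_re_le_norm (z + Complex.I)
    have h1 : ‖∫ x in (-T)..T, h (x + T * Complex.I)‖ ≤ M / T ^ 2 * |T - -T| := by
      refine intervalIntegral.norm_integral_le_of_norm_le_const fun x _ => ?_
      refine hsmall T hT _ (by simpa using hT.le) ?_
      have := Complex.abs_im_le_norm ((x : ℂ) + T * Complex.I + Complex.I)
      simp at this
      exact le_trans (by linarith [le_abs_self (T + 1)]) this
    have h2 : ‖∫ y in (0 : ℝ)..T, h (T + y * Complex.I)‖ ≤ M / T ^ 2 * |T - 0| := by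
      refine intervalIntegral.norm_integral_le_of_norm_le_const fun y hy => ?_
      rw [Set.uIoc_of_le hT.le] at hy
      refine hsmall T hT _ (by simpa using hy.1.le) ?_
      have := hre (T + y * Complex.I)
      simp only [Complex.add_re, Complex.ofReal_re, Complex.mul_re, Complex.I_re, mul_zero,
        Complex.ofReal_im, Complex.I_im, zero_mul, sub_zero, add_zero] at this
      exact (le_abs_self T).trans this
    have h3 : ‖∫ y in (0 : ℝ)..T, h (((-T : ℝ) : ℂ) + y * Complex.I)‖ ≤ M / T ^ 2 * |T - 0| := by
      refine intervalIntegral.norm_integral_le_of_norm_le_const fun y hy => ?_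
      rw [Set.uIoc_of_le hT.le] at hy
      refine hsmall T hT _ (by simpa using hy.1.le) ?_
      have := hre (((-T : ℝ) : ℂ) + y * Complex.I)
      simp only [Complex.add_re, Complex.ofReal_re, Complex.mul_re, Complex.I_re, mul_zero,
        Complex.ofReal_im, Complex.I_im, zero_mul, sub_zero, add_zero, abs_neg] at this
      exact (le_abs_self T).trans this
    have e : ∫ x in (-T)..T, h x = (∫ x in (-T)..T, h (x + T * Complex.I)) -
        Complex.I * (∫ y in (0 : ℝ)..T, h (T + y * Complex.I)) +
        Complex.I * (∫ y in (0 : ℝ)..T, h (((-T : ℝ) : ℂ) + y * Complex.I)) := by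
      linear_combination hrect
    rw [e]
    refine (norm_add_le _ _).trans ((add_le_add_left (norm_sub_le _ _) _).trans ?_)
    rw [norm_mul, norm_mul, Complex.norm_I, one_mul, one_mul]
    refine (add_le_add (add_le_add h1 h2) h3).trans_eq ?_
    rw [sub_neg_eq_add, sub_zero, abs_of_pos hT, abs_of_pos (by linarith)]
    field_simp; ring
  rw [Real.fourier_real_eq_integral_exp_smul]
  have hlim2 := intervalIntegral_tendsto_integral hint tendsto_neg_atTop_atBot tendsto_id
  rw [← tendsto_nhds_unique hlim2 hlim]
  refine integral_congr_ae (Eventually.of_forall fun x => ?_)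
  simp only [hh, smul_eq_mul]
  congr 2
  push_cast; ring

/-- Frequencies above `a` reduce to those below `-a` under `z ↦ -z`. -/
theorem tsupport_fourier_subset {Φ : ℂ → ℂ} (hΦ : Differentiable ℂ Φ) {a : ℝ} (ha : 0 ≤ a)
    (hexp : HasExpType Φ (2 * Real.pi * a)) (hdec : HasRapidDecay fun x : ℝ => Φ x) :
    tsupport (𝓕 (fun x : ℝ => Φ x)) ⊆ Set.Icc (-a) a := by
  obtain ⟨M, hM⟩ := hdec.exists_one_add_sq_mul_le 0
  simp only [pow_zero, one_mul] at hM
  refine closure_minimal (fun ξ hξ => ?_) isClosed_Icc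
  by_contra hout
  rw [Set.mem_Icc, not_and_or, not_le, not_le] at hout
  apply hξ
  rcases hout with h | h
  · exact fourier_eq_zero_of_lt_neg hΦ ha hexp hM h
  · have h2 := fourier_eq_zero_of_lt_neg (Φ := fun z => Φ (-z)) (by fun_prop) ha hexp.comp_neg
      (fun x => by simpa using hM (-x)) (neg_lt_neg h)
    rw [← h2, Real.fourier_real_eq_integral_exp_smul, Real.fourier_real_eq_integral_exp_smul,
      ← integral_neg_eq_self]
    refine integral_congr_ae (Eventually.of_forall fun x => ?_)
    simp

/-- A real-valued rapidly decaying entire function of exponential type restricts to a Schwartz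
function with compactly supported Fourier transform. -/
theorem exists_schwartzMap_of_hasExpType {Φ : ℂ → ℂ} (hΦ : Differentiable ℂ Φ) {a : ℝ}
    (ha : 0 ≤ a) (hexp : HasExpType Φ (2 * Real.pi * a))
    (hdec : HasRapidDecay fun x : ℝ => Φ x) {p : ℝ → ℝ} (hp : ∀ x : ℝ, Φ x = p x) :
    ∃ φ : 𝓢(ℝ, ℝ), (∀ x, φ x = p x) ∧
      tsupport (𝓕 fun x : ℝ => (φ x : ℂ)) ⊆ Set.Icc (-a) a := by
  have hc : Continuous fun x : ℝ => Φ x := hΦ.continuous.comp Complex.continuous_ofReal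
  have hsupp := tsupport_fourier_subset hΦ ha hexp hdec
  have hcpt : HasCompactSupport (𝓕 (fun x : ℝ => Φ x)) :=
    isCompact_Icc.of_isClosed_subset (isClosed_tsupport _) hsupp
  -- The transform is smooth with compact support, hence Schwartz; inverting it shows that `Φ` is
  -- Schwartz on the line without estimating its derivatives.
  have hsm : ContDiff ℝ ((⊤ : ℕ∞) : WithTop ℕ∞) (𝓕 (fun x : ℝ => Φ x)) :=
    Real.contDiff_fourier fun n _ => hdec.integrable_pow_mul hc n
  let ψ : 𝓢(ℝ, ℂ) := hcpt.toSchwartzMap hsm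
  have hψ : (ψ : ℝ → ℂ) = 𝓕 (fun x : ℝ => Φ x) := rfl
  have hinv : ∀ x : ℝ, (𝓕⁻ ψ) x = Φ x := by
    intro x
    rw [SchwartzMap.fourierInv_coe, hψ, hc.fourierInv_fourier_eq (hdec.integrable hc)
      (hψ ▸ ψ.integrable)]
  have hval : ∀ x, (𝓕⁻ ψ).postcompCLM Complex.reCLM x = p x := by
    intro x
    rw [SchwartzMap.postcompCLM_apply, hinv, hp, Complex.reCLM_apply, Complex.ofReal_re]
  refine ⟨(𝓕⁻ ψ).postcompCLM Complex.reCLM, hval, ?_⟩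
  have : (fun x : ℝ => (((𝓕⁻ ψ).postcompCLM Complex.reCLM x : ℝ) : ℂ)) = fun x : ℝ => Φ x := by
    funext x
    rw [hval, hp]
  rw [this]
  exact hsupp

/-! ### The mollifier -/

/-- There is an entire function of exponential type `2π`, rapidly decaying and bounded by `1` on the
real line, which takes the value `1` at `0`. -/
theorem exists_rapidly_decaying_entire : ∃ η : ℂ → ℂ, Differentiable ℂ η ∧
    HasExpType η (2 * Real.pi) ∧ η 0 = 1 ∧ (∀ x : ℝ, ‖η x‖ ≤ 1) ∧
    HasRapidDecay fun x : ℝ => η x := by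
  -- `η(z) = ∫ w(x) e^{2πixz} dx` for a smooth probability density `w` on `[-1, 1]`: the support
  -- gives the type, the unit mass gives `η(0) = 1` and `|η| ≤ 1`, the smoothness gives decay.
  let β : ContDiffBump (0 : ℝ) := ⟨1 / 2, 1, by norm_num, by norm_num⟩
  set w : ℝ → ℝ := β.normed volume with hw
  have hw0 : ∀ x, 0 ≤ w x := β.nonneg_normed
  have hwc : Continuous w := β.continuous_normed
  have hwi : Integrable w := β.integrable_normed
  let μ : Measure ℝ := volume.withDensity fun x => ENNReal.ofReal (w x)
  have hμ1 : IsProbabilityMeasure μ := by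
    refine ⟨?_⟩
    rw [withDensity_apply _ MeasurableSet.univ, setLIntegral_univ,
      ← ofReal_integral_eq_lintegral_ofReal hwi (Eventually.of_forall hw0), β.integral_normed,
      ENNReal.ofReal_one]
  have hμ : ∀ g : ℝ → ℂ, ∫ x, g x ∂μ = ∫ x, (w x : ℂ) * g x := by
    intro g
    rw [integral_withDensity_eq_integral_toReal_smul (by fun_prop)
      (Eventually.of_forall fun x => ENNReal.ofReal_lt_top)]
    refine integral_congr_ae (Eventually.of_forall fun x => ?_)
    simp [ENNReal.toReal_ofReal (hw0 x)]
  have hsupp : ∀ᵐ x ∂μ, |x| ≤ 1 := by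
    rw [ae_withDensity_iff (by fun_prop)]
    refine Eventually.of_forall fun x hx => ?_
    have h1 : x ∈ Function.support w := by
      intro h0; apply hx; simp [h0]
    rw [hw, β.support_normed_eq] at h1
    have h2 : |x| < 1 := by simpa using h1
    exact h2.le
  have hexpb : ∀ t : ℝ, ∀ᵐ x ∂μ, ‖Real.exp (t * x)‖ ≤ Real.exp |t| := by
    intro t
    filter_upwards [hsupp] with x hx
    rw [Real.norm_of_nonneg (Real.exp_pos _).le]
    gcongr
    calc t * x ≤ |t * x| := le_abs_self _
      _ = |t| * |x| := abs_mul _ _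
      _ ≤ |t| := mul_le_of_le_one_right (abs_nonneg _) hx
  have hset : ProbabilityTheory.integrableExpSet id μ = Set.univ := by
    refine Set.eq_univ_of_forall fun t => ?_
    exact Integrable.of_bound (by fun_prop) _ (hexpb t)
  have hreal : ∀ x : ℝ, ProbabilityTheory.complexMGF id μ (2 * Real.pi * Complex.I * x) =
      charFun μ (2 * Real.pi * x) := by
    intro x
    rw [← ProbabilityTheory.complexMGF_id_mul_I]
    congr 1
    push_cast; ring
  refine ⟨fun z => ProbabilityTheory.complexMGF id μ (2 * Real.pi * Complex.I * z), ?_, ?_, ?_,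
    ?_, ?_⟩
  · have h1 : Differentiable ℂ (ProbabilityTheory.complexMGF id μ) := by
      have := ProbabilityTheory.differentiableOn_complexMGF (X := id) (μ := μ)
      simp only [hset, interior_univ, Set.mem_univ, Set.ofPred_true] at this
      exact differentiableOn_univ.1 this
    exact h1.comp (by fun_prop)
  · intro b hb
    refine ⟨1, fun z => ?_⟩
    refine (ProbabilityTheory.norm_complexMGF_le_mgf).trans ?_
    have h1 : ProbabilityTheory.mgf id μ (2 * Real.pi * Complex.I * z).re ≤
        Real.exp |(2 * Real.pi * Complex.I * z).re| := by
      refine (le_abs_self _).trans ?_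
      have := norm_integral_le_of_norm_le_const (hexpb (2 * Real.pi * Complex.I * z).re)
      rw [ProbabilityTheory.mgf]
      simpa using this
    rw [one_mul]
    refine h1.trans ?_
    gcongr
    refine (Complex.abs_re_le_norm _).trans ?_
    rw [norm_mul, norm_mul, norm_mul, Complex.norm_I, Complex.norm_real,
      Real.norm_of_nonneg Real.pi_pos.le]
    simp only [Complex.norm_ofNat, mul_one]
    gcongr
  · have := hreal 0
    simpa using this
  · intro x
    beta_reduce
    rw [hreal]
    exact norm_charFun_le_one _
  · have hcs : HasCompactSupport fun x => (w x : ℂ) :=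
      β.hasCompactSupport_normed.comp_left (g := fun y : ℝ => (y : ℂ)) (by simp)
    have hsm : ContDiff ℝ ((⊤ : ℕ∞) : WithTop ℕ∞) fun x => (w x : ℂ) :=
      Complex.ofRealCLM.contDiff.comp β.contDiff_normed
    intro k
    obtain ⟨C, hC0, hC⟩ := (𝓕⁻ (hcs.toSchwartzMap hsm)).decay k 0
    refine ⟨C, fun x => ?_⟩
    have h1 := hC x
    rw [norm_iteratedFDeriv_zero, Real.norm_eq_abs] at h1
    refine le_of_eq_of_le ?_ h1
    congr 2
    rw [SchwartzMap.fourierInv_coe, Real.fourierInv_eq']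
    beta_reduce
    rw [ProbabilityTheory.complexMGF, hμ]
    refine integral_congr_ae (Eventually.of_forall fun v => ?_)
    simp only [HasCompactSupport.toSchwartzMap_toFun, smul_eq_mul, id]
    rw [mul_comm]
    congr 2
    simp; ring

/-! ### The measure `W_G` -/

namespace SymmetryGroup

variable (G : SymmetryGroup)

/-- The absolutely continuous part of `W_G`. -/
def weight (x : ℝ) : ℝ := 1 + G.sincCoeff * Real.sinc (2 * Real.pi * x)

theorem continuous_weight : Continuous G.weight := by
  unfold weight
  have := Real.continuous_sinc
  fun_prop

theorem abs_weight_sub_one_le (x : ℝ) : |G.weight x - 1| ≤ |Real.sinc (2 * Real.pi * x)| := by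
  rw [weight, add_sub_cancel_left, abs_mul]
  refine mul_le_of_le_one_left (abs_nonneg _) ?_
  cases G <;> simp [sincCoeff]

theorem weight_nonneg (x : ℝ) : 0 ≤ G.weight x := by
  have := abs_le.1 ((G.abs_weight_sub_one_le x).trans (Real.abs_sinc_le_one _))
  linarith [this.1]

theorem weight_le_two (x : ℝ) : G.weight x ≤ 2 := by
  have := abs_le.1 ((G.abs_weight_sub_one_le x).trans (Real.abs_sinc_le_one _))
  linarith [this.2]

theorem weight_neg (x : ℝ) : G.weight (-x) = G.weight x := by
  simp [weight, Real.sinc_neg]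

/-- The weight may vanish at 0 (as for `Sp`), so comparison with Lebesgue measure is made only away
from 0. -/
theorem half_le_weight {x : ℝ} (hx : 1 ≤ |x|) : 1 / 2 ≤ G.weight x := by
  have h1 : |Real.sinc (2 * Real.pi * x)| ≤ 1 / 2 := by
    have h2 : 2 ≤ |2 * Real.pi * x| := by
      rw [abs_mul, abs_of_pos (by positivity)]
      nlinarith [Real.pi_gt_three]
    have h3 : 2 * Real.pi * x ≠ 0 := by
      intro h; rw [h, abs_zero] at h2; linarith
    rw [Real.sinc_of_ne_zero h3, abs_div, div_le_iff₀ (by linarith)]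
    linarith [Real.abs_sin_le_one (2 * Real.pi * x)]
  linarith [(abs_le.1 ((G.abs_weight_sub_one_le x).trans h1)).1]

theorem deltaCoeff_nonneg : 0 ≤ G.deltaCoeff := by
  cases G <;> simp [deltaCoeff]

theorem density_eq : G.density = volume.withDensity (fun x => ENNReal.ofReal (G.weight x)) +
    ENNReal.ofReal G.deltaCoeff • Measure.dirac 0 := rfl

theorem measurable_ofReal_weight : Measurable fun x => ENNReal.ofReal (G.weight x) :=
  G.continuous_weight.measurable.ennreal_ofReal

theorem integrable_withDensity_weight_iff {f : ℝ → ℝ} :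
    Integrable f (volume.withDensity fun x => ENNReal.ofReal (G.weight x)) ↔
      Integrable fun x => G.weight x * f x := by
  rw [integrable_withDensity_iff_integrable_smul' G.measurable_ofReal_weight
    (Eventually.of_forall fun x => ENNReal.ofReal_lt_top)]
  simp [ENNReal.toReal_ofReal (G.weight_nonneg _)]

theorem integrable_weight_mul {f : ℝ → ℝ} (hf : Integrable f) :
    Integrable fun x => G.weight x * f x :=
  hf.bdd_mul (c := 2) G.continuous_weight.aestronglyMeasurable
    (Eventually.of_forall fun x => by
      rw [Real.norm_of_nonneg (G.weight_nonneg x)]; exact G.weight_le_two x)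

theorem integrable_dirac_part {f : ℝ → ℝ} :
    Integrable f (ENNReal.ofReal G.deltaCoeff • Measure.dirac 0) :=
  (integrable_dirac (by simp)).smul_measure ENNReal.ofReal_ne_top

theorem integrable_density {f : ℝ → ℝ} (hf : Integrable f) : Integrable f G.density := by
  rw [density_eq]
  exact (G.integrable_withDensity_weight_iff.2 (G.integrable_weight_mul hf)).add_measure
    G.integrable_dirac_part

theorem integral_density {f : ℝ → ℝ} (hf : Integrable f) :
    ∫ x, f x ∂G.density = (∫ x, G.weight x * f x) + G.deltaCoeff * f 0 := by
  rw [density_eq, integral_add_measure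
    (G.integrable_withDensity_weight_iff.2 (G.integrable_weight_mul hf)) G.integrable_dirac_part,
    integral_smul_measure, integral_dirac, ENNReal.toReal_ofReal G.deltaCoeff_nonneg,
    integral_withDensity_eq_integral_toReal_smul G.measurable_ofReal_weight
      (Eventually.of_forall fun x => ENNReal.ofReal_lt_top)]
  simp [ENNReal.toReal_ofReal (G.weight_nonneg _)]

/-- Finiteness of the second moment against `W_G` implies finiteness against Lebesgue measure. -/
theorem integrable_sq_mul_of_density {g : ℝ → ℝ} (hg0 : ∀ x, 0 ≤ g x) (hgc : Continuous g)
    (hg : Integrable g) {α : ℝ} (h : Integrable (fun x => (x - α) ^ 2 * g x) G.density) :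
    Integrable fun x => (x - α) ^ 2 * g x := by
  rw [density_eq] at h
  have h1 := G.integrable_withDensity_weight_iff.1 h.left_of_add_measure
  refine ((h1.const_mul 2).add (hg.const_mul ((1 + |α|) ^ 2))).mono' (by fun_prop)
    (Eventually.of_forall fun x => ?_)
  have hx0 : 0 ≤ (x - α) ^ 2 * g x := mul_nonneg (sq_nonneg _) (hg0 x)
  rw [Real.norm_of_nonneg hx0]
  show _ ≤ 2 * (G.weight x * ((x - α) ^ 2 * g x)) + (1 + |α|) ^ 2 * g x
  rcases le_total 1 |x| with hx | hx
  · have h2 := G.half_le_weight hx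
    have h3 : 0 ≤ (1 + |α|) ^ 2 * g x := mul_nonneg (sq_nonneg _) (hg0 x)
    nlinarith
  · have h2 : (x - α) ^ 2 ≤ (1 + |α|) ^ 2 := by
      rw [← sq_abs (x - α)]
      have : |x - α| ≤ 1 + |α| := (abs_sub _ _).trans (by linarith)
      gcongr
    have h3 := mul_nonneg (G.weight_nonneg x) hx0
    have h4 := mul_le_mul_of_nonneg_right h2 (hg0 x)
    linarith

/-- A non-zero entire function has positive mass with respect to `W_G`. -/
theorem lintegral_density_ne_zero {F : ℂ → ℂ} (hF : Differentiable ℂ F) (hF0 : F ≠ 0) :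
    ∫⁻ x : ℝ, ‖F x‖ₑ ^ 2 ∂G.density ≠ 0 := by
  intro h
  have hc : Continuous fun x : ℝ => F x := hF.continuous.comp Complex.continuous_ofReal
  rw [lintegral_eq_zero_iff (hc.enorm.measurable.pow_const 2), density_eq] at h
  have h1 : ∀ᵐ x : ℝ ∂volume.withDensity (fun x => ENNReal.ofReal (G.weight x)), F x = 0 := by
    have := (ae_add_measure_iff.1 h).1
    filter_upwards [this] with x hx
    simpa using hx
  rw [ae_withDensity_iff G.measurable_ofReal_weight] at h1
  -- On this interval the weight is at least `1/2`, so `F` vanishes almost everywhere there, hence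
  -- everywhere there by continuity; the identity theorem finishes.
  have h2 : Set.EqOn (fun x : ℝ => F x) (fun _ => 0) (Set.Ioo 1 2) := by
    refine Measure.eqOn_open_of_ae_eq (μ := volume) ?_ isOpen_Ioo hc.continuousOn
      continuousOn_const
    rw [Filter.EventuallyEq, ae_restrict_iff' measurableSet_Ioo]
    filter_upwards [h1] with x hx hx12
    apply hx
    have := G.half_le_weight (x := x) (hx12.1.le.trans (le_abs_self x))
    rw [Ne, ENNReal.ofReal_eq_zero, not_le]
    linarith
  apply hF0
  have hFa : AnalyticOnNhd ℂ F Set.univ := fun z _ => hF.analyticAt z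
  have h0a : AnalyticOnNhd ℂ (0 : ℂ → ℂ) Set.univ := fun z _ => analyticAt_const
  refine hFa.eq_of_frequently_eq (z₀ := ((3 / 2 : ℝ) : ℂ)) h0a ?_
  have ht : Tendsto (fun x : ℝ => (x : ℂ)) (𝓝[≠] (3 / 2)) (𝓝[≠] ((3 / 2 : ℝ) : ℂ)) :=
    Complex.continuous_ofReal.continuousAt.tendsto.inf
      (tendsto_principal_principal.2 fun x hx => by
        simpa only [Set.mem_compl_iff, Set.mem_singleton_iff, Complex.ofReal_inj] using hx)
  refine ht.frequently (Eventually.frequently ?_)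
  refine nhdsWithin_le_nhds ?_
  filter_upwards [Ioo_mem_nhds (show (1 : ℝ) < 3 / 2 by norm_num)
    (show (3 / 2 : ℝ) < 2 by norm_num)] with x hx
  exact h2 hx

end SymmetryGroup

/-! ### The test function -/

/-- If `F` has exponential type `πΔ` and `∫ |(x - α) F|² W_G < s² ∫ |F|² W_G`, there is an even
Schwartz function with Fourier support in `(-Δ, Δ)` and negative integral against `W_G`, which is
non-negative away from the `s`-neighbourhoods of `α` and `-α`. -/
theorem exists_test_function (G : SymmetryGroup) {Δ : ℝ} (hΔ : 0 < Δ) {α s : ℝ} (hs : 0 ≤ s)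
    {F : ℂ → ℂ} (hF : Differentiable ℂ F) (hexp : HasExpType F (Real.pi * Δ))
    (hL2 : MemLp (fun x : ℝ => F x) 2 volume)
    (hlt : ∫⁻ x : ℝ, ‖((x : ℂ) - α) * F x‖ₑ ^ 2 ∂G.density <
      ENNReal.ofReal (s ^ 2) * ∫⁻ x : ℝ, ‖F x‖ₑ ^ 2 ∂G.density) :
    ∃ φ : 𝓢(ℝ, ℝ), (∀ x, φ (-x) = φ x) ∧
      tsupport (𝓕 fun x : ℝ => (φ x : ℂ)) ⊆ Set.Ioo (-Δ) Δ ∧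
      ∫ x, φ x ∂G.density < 0 ∧ ∀ x, φ x < 0 → |x - α| < s ∨ |-x - α| < s := by
  have hpi := Real.pi_pos
  obtain ⟨M, hM⟩ := hexp.exists_norm_le_linear hF (by positivity) hL2
  obtain ⟨η, hηd, hηe, hη0, hη1, hηr⟩ := exists_rapidly_decaying_entire
  have hFc : Continuous fun x : ℝ => F x := hF.continuous.comp Complex.continuous_ofReal
  have hηc : Continuous fun x : ℝ => η x := hηd.continuous.comp Complex.continuous_ofReal
  set g : ℝ → ℝ := fun x => ‖F x‖ ^ 2 with hg
  set h : ℝ → ℝ := fun x => ‖η x‖ ^ 2 with hh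
  have hgc : Continuous g := hFc.norm.pow 2
  have hhc : Continuous h := hηc.norm.pow 2
  have hg0 : ∀ x, 0 ≤ g x := fun x => sq_nonneg _
  have hh0 : ∀ x, 0 ≤ h x := fun x => sq_nonneg _
  have hh1 : ∀ x, h x ≤ 1 := fun x => pow_le_one₀ (norm_nonneg _) (hη1 x)
  have hgi : Integrable g := hL2.integrable_norm_pow (by norm_num)
  have e1 : ∀ x : ℝ, ‖((x : ℂ) - α) * F x‖ₑ ^ 2 = ENNReal.ofReal ((x - α) ^ 2 * g x) := by
    intro x
    rw [← ofReal_norm, ← ENNReal.ofReal_pow (norm_nonneg _), norm_mul, mul_pow,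
      ← Complex.ofReal_sub, Complex.norm_real, Real.norm_eq_abs, sq_abs]
  have e2 : ∀ x : ℝ, ‖F x‖ₑ ^ 2 = ENNReal.ofReal (g x) := by
    intro x
    rw [← ofReal_norm, ← ENNReal.ofReal_pow (norm_nonneg _)]
  have hmν : Integrable (fun x => (x - α) ^ 2 * g x) G.density := by
    refine ⟨by fun_prop, ?_⟩
    rw [hasFiniteIntegral_iff_ofReal
      (Eventually.of_forall fun x => mul_nonneg (sq_nonneg _) (hg0 x))]
    simp only [← e1]
    exact hlt.trans_le le_top
  have hmi := G.integrable_sq_mul_of_density hg0 hgc hgi hmν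
  have hneg : (∫ x, G.weight x * (((x - α) ^ 2 - s ^ 2) * g x)) +
      G.deltaCoeff * ((α ^ 2 - s ^ 2) * g 0) < 0 := by
    simp only [e1, e2] at hlt
    rw [← ofReal_integral_eq_lintegral_ofReal hmν
      (Eventually.of_forall fun x => mul_nonneg (sq_nonneg _) (hg0 x)),
      ← ofReal_integral_eq_lintegral_ofReal (G.integrable_density hgi)
      (Eventually.of_forall hg0), ← ENNReal.ofReal_mul (sq_nonneg _),
      ENNReal.ofReal_lt_ofReal_iff_of_nonneg
        (integral_nonneg fun x => mul_nonneg (sq_nonneg _) (hg0 x)),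
      ← integral_const_mul, ← sub_neg, ← integral_sub hmν
        ((G.integrable_density hgi).const_mul _)] at hlt
    have hi : Integrable fun x => (x - α) ^ 2 * g x - s ^ 2 * g x := hmi.sub (hgi.const_mul _)
    rw [G.integral_density hi] at hlt
    refine lt_of_eq_of_lt ?_ hlt
    congr 1
    · refine integral_congr_ae (Eventually.of_forall fun x => ?_)
      simp only; ring
    · ring
  -- The integrand after substituting `v = r x`: `F` is no longer dilated, so one dominating
  -- function serves all `r` near 1.
  set K : ℝ → ℝ → ℝ := fun r v => G.weight (v / r) *
    (((v / r - α) ^ 2 - s ^ 2) * (g v * h ((1 - r) * (Δ / 8) * (v / r)))) with hK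
  have hJ : Tendsto (fun r => ∫ v, K r v) (𝓝 1) (𝓝 (∫ v, K 1 v)) := by
    refine tendsto_integral_filter_of_dominated_convergence
      (fun v => 2 * (16 * ((v - α) ^ 2 * g v) + (18 * α ^ 2 + s ^ 2) * g v)) ?_ ?_ ?_ ?_
    · refine Eventually.of_forall fun r => Continuous.aestronglyMeasurable ?_
      have := G.continuous_weight
      simp only [hK]
      fun_prop
    · filter_upwards [Ioi_mem_nhds (show (1 / 2 : ℝ) < 1 by norm_num)] with r hr
      refine Eventually.of_forall fun v => ?_
      have hr : 1 / 2 < r := hr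
      have hr2 : (v / r) ^ 2 ≤ 4 * v ^ 2 := by
        rw [div_pow, div_le_iff₀ (by positivity)]
        nlinarith [sq_nonneg v, mul_nonneg (sq_nonneg v) (show 0 ≤ r ^ 2 - 1 / 4 by nlinarith)]
      -- From `(v/r - α)² ≤ 8v² + 2α²` and `v² ≤ 2(v - α)² + 2α²`.
      have hq : |(v / r - α) ^ 2 - s ^ 2| ≤ 16 * (v - α) ^ 2 + (18 * α ^ 2 + s ^ 2) := by
        rw [abs_le]
        constructor <;>
          nlinarith [sq_nonneg (v / r - α), sq_nonneg (v / r + α), sq_nonneg (v - 2 * α),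
            sq_nonneg s, sq_nonneg α, sq_nonneg (v - α)]
      rw [Real.norm_eq_abs, abs_mul, abs_mul, abs_of_nonneg (G.weight_nonneg _),
        abs_of_nonneg (mul_nonneg (hg0 v) (hh0 _))]
      calc _ ≤ 2 * ((16 * (v - α) ^ 2 + (18 * α ^ 2 + s ^ 2)) * (g v * 1)) := by
            gcongr
            exacts [G.weight_le_two _, hh1 _]
        _ = _ := by ring
    · exact ((hmi.const_mul 16).add (hgi.const_mul _)).const_mul 2
    · refine Eventually.of_forall fun v => ?_
      have hv : ContinuousAt (fun r : ℝ => v / r) 1 := by fun_prop (disch := norm_num)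
      have h1 : ContinuousAt (fun r : ℝ => G.weight (v / r)) 1 :=
        ContinuousAt.comp (g := G.weight) G.continuous_weight.continuousAt hv
      have h2 : ContinuousAt (fun r : ℝ => h ((1 - r) * (Δ / 8) * (v / r))) 1 :=
        ContinuousAt.comp (g := h) hhc.continuousAt (by fun_prop (disch := norm_num))
      have h3 : ContinuousAt (fun r => K r v) 1 := by
        simp only [hK]; fun_prop (disch := norm_num)
      exact h3.tendsto
  have hK1 : ∫ v, K 1 v = ∫ x, G.weight x * (((x - α) ^ 2 - s ^ 2) * g x) := by
    have : h 0 = 1 := by simp [hh, hη0]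
    simp [hK, this]
  -- Here `r⁻¹` is the Jacobian; the delta term is independent of `r` because `η(0) = 1`.
  have hlim : Tendsto (fun r => r⁻¹ * (∫ v, K r v) + G.deltaCoeff * ((α ^ 2 - s ^ 2) * g 0))
      (𝓝[<] 1) (𝓝 ((1 : ℝ)⁻¹ * (∫ x, G.weight x * (((x - α) ^ 2 - s ^ 2) * g x)) +
        G.deltaCoeff * ((α ^ 2 - s ^ 2) * g 0))) := by
    rw [hK1] at hJ
    refine Tendsto.mono_left ?_ nhdsWithin_le_nhds
    exact ((tendsto_inv₀ one_ne_zero).mul hJ).add_const _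
  rw [inv_one, one_mul] at hlim
  obtain ⟨r, hr, hr0, hr1⟩ := ((hlim.eventually_lt_const hneg).and
    (Ioo_mem_nhdsLT (show (0 : ℝ) < 1 by norm_num))).exists
  -- Makes the Fourier radius `rΔ + 2ε = rΔ + (1 - r)Δ/4` smaller than `Δ`.
  set ε : ℝ := (1 - r) * (Δ / 8) with hε
  have hε0 : 0 < ε := by rw [hε]; apply mul_pos <;> linarith
  set E : ℂ → ℂ := fun z => F (r * z) * η (ε * z) with hE
  have hEd : Differentiable ℂ E := by
    refine Differentiable.mul (hF.comp (by fun_prop)) (hηd.comp (by fun_prop))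
  have hEe : HasExpType E (r * (Real.pi * Δ) + ε * (2 * Real.pi)) :=
    (hexp.comp_mul hr0).mul (hηe.comp_mul hε0)
  have hEr : HasRapidDecay fun x : ℝ => E x := by
    have h1 : HasRapidDecay fun x : ℝ => η ((ε : ℂ) * x) := by
      have := hηr.comp_mul hε0
      simpa only [Complex.ofReal_mul] using this
    refine h1.mul_of_linear_growth (g := fun x : ℝ => F (r * x)) (M := M) fun x => ?_
    have h2 := hM (r * x)
    have hM0 : 0 ≤ M := by
      have := (norm_nonneg _).trans (hM 0)
      simpa using this
    rw [Complex.ofReal_mul, abs_mul, abs_of_pos hr0] at h2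
    refine h2.trans ?_
    gcongr
    exact mul_le_of_le_one_left (abs_nonneg x) hr1.le
  have hEn : ∀ x : ℝ, ‖E x‖ ^ 2 = g (r * x) * h (ε * x) := by
    intro x
    simp only [hE, hg, hh, norm_mul, mul_pow, Complex.ofReal_mul]
  set p : ℝ → ℝ := fun x => ((x - α) ^ 2 - s ^ 2) * (g (r * x) * h (ε * x)) with hp
  -- The entire extension of `p`: `conj (E (conj z)) * E z` extends `|E|²`, and the linear factors
  -- add no exponential type.
  set Ψ : ℂ → ℂ := fun z =>
    (z + ((-α - s : ℝ) : ℂ)) * ((z + ((-α + s : ℝ) : ℂ)) * (conj (E (conj z)) * E z)) with hΨ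
  have hΨp : ∀ x : ℝ, Ψ x = p x := by
    intro x
    have h1 : conj (E (conj (x : ℂ))) * E x = ((‖E x‖ ^ 2 : ℝ) : ℂ) := by
      rw [Complex.conj_ofReal, mul_comm, Complex.mul_conj, Complex.sq_norm]
    simp only [hΨ, hp, h1, hEn]
    push_cast; ring
  have hEcd : Differentiable ℂ fun z => conj (E (conj z)) := by
    intro z
    have := (hEd (conj z)).conj_conj
    rw [Complex.conj_conj] at this
    exact this
  have hΨd : Differentiable ℂ Ψ := by
    simp only [hΨ]
    fun_prop
  set a : ℝ := r * Δ + 2 * ε with ha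
  have ha0 : 0 ≤ a := by positivity
  have haΔ : a < Δ := by rw [ha, hε]; nlinarith
  have hΨe : HasExpType Ψ (2 * Real.pi * a) := by
    have h1 : ∀ w : ℂ, HasExpType (fun z => z + w) 0 := fun w =>
      HasExpType.id.add (HasExpType.const w)
    have := (h1 ((-α - s : ℝ) : ℂ)).mul ((h1 ((-α + s : ℝ) : ℂ)).mul (hEe.conj_conj.mul hEe))
    refine this.mono (le_of_eq ?_)
    rw [ha]; ring
  have hlin : ∀ t x : ℝ, ‖(x : ℂ) + (t : ℂ)‖ ≤ (1 + |t|) * (1 + |x|) := by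
    intro t x
    rw [← Complex.ofReal_add, Complex.norm_real, Real.norm_eq_abs]
    refine (abs_add_le x t).trans ?_
    nlinarith [abs_nonneg x, abs_nonneg t, mul_nonneg (abs_nonneg t) (abs_nonneg x)]
  have hΨr : HasRapidDecay fun x : ℝ => Ψ x := by
    obtain ⟨C, hC⟩ := hEr 0
    refine ((hEr.mul_of_linear_growth (g := fun x : ℝ => conj (E (conj (x : ℂ)))) (M := C)
      fun x => ?_).mul_of_linear_growth (hlin (-α + s))).mul_of_linear_growth (hlin (-α - s))
    have h1 := hC x
    rw [pow_zero, one_mul] at h1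
    have hC0 : 0 ≤ C := (norm_nonneg _).trans h1
    rw [Complex.conj_ofReal, RCLike.norm_conj]
    nlinarith [abs_nonneg x]
  have hpi' : Integrable p := by
    have := hΨr.integrable (hΨd.continuous.comp Complex.continuous_ofReal)
    simp only [hΨp] at this
    exact this.re
  obtain ⟨φ, hφ, hsupp⟩ := exists_schwartzMap_of_hasExpType (Φ := fun z => Ψ z + Ψ (-z))
    (by fun_prop) ha0 (hΨe.add hΨe.comp_neg)
    (by simpa only [Complex.ofReal_neg] using hΨr.add hΨr.comp_neg)
    (p := fun x => p x + p (-x)) (fun x => by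
      simp only [← Complex.ofReal_neg, hΨp, Complex.ofReal_add])
  refine ⟨φ, fun x => ?_, hsupp.trans (Set.Icc_subset_Ioo (by linarith) haΔ), ?_, fun x hx => ?_⟩
  · rw [hφ, hφ, neg_neg, add_comm]
  · have hpn : Integrable fun x => p (-x) := hpi'.comp_neg
    have hsymm : ∫ x, p (-x) ∂G.density = ∫ x, p x ∂G.density := by
      rw [G.integral_density hpi', G.integral_density hpn, neg_zero,
        ← integral_neg_eq_self (fun x => G.weight x * p x)]
      simp only [G.weight_neg]
    have hval : ∫ x, p x ∂G.density < 0 := by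
      rw [G.integral_density hpi']
      refine lt_of_eq_of_lt ?_ hr
      congr 1
      · have h1 := Measure.integral_comp_mul_left (K r) r
        rw [abs_of_pos (inv_pos.2 hr0), smul_eq_mul] at h1
        rw [← h1]
        refine integral_congr_ae (Eventually.of_forall fun x => ?_)
        simp only [hK, hp, mul_div_cancel_left₀ x hr0.ne', hε]
      · simp [hp, hh, hη0]
    simp only [hφ]
    rw [integral_add (G.integrable_density hpi') (G.integrable_density hpn), hsymm]
    linarith
  · have hpos : ∀ y, s ≤ |y - α| → 0 ≤ p y := by
      intro y hy
      refine mul_nonneg ?_ (mul_nonneg (hg0 _) (hh0 _))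
      rw [sub_nonneg, ← sq_abs (y - α)]
      gcongr
    by_contra! hcon
    rw [hφ] at hx
    linarith [hpos x hcon.1, hpos (-x) hcon.2]

/-! ### Zeros of a single `L`-function -/

namespace LFunction

variable (f : LFunction)

theorem three_le_analyticConductor : 3 ≤ f.analyticConductor := by
  have h1 : ∀ t : Multiset ℂ, 1 ≤ (t.map fun k => ‖k‖ + 3).prod := by
    intro t
    induction t using Multiset.induction with
    | empty => simp
    | cons k t ih =>
      rw [Multiset.map_cons, Multiset.prod_cons]
      nlinarith [norm_nonneg k]
  obtain ⟨k, hk⟩ := Multiset.card_pos_iff_exists_mem.1 f.degree_pos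
  obtain ⟨t, ht⟩ := Multiset.exists_cons_of_mem hk
  have h2 : 3 ≤ (f.kappa.map fun k => ‖k‖ + 3).prod := by
    rw [ht, Multiset.map_cons, Multiset.prod_cons]
    nlinarith [norm_nonneg k, h1 t]
  have h3 : (1 : ℝ) ≤ f.conductor := by exact_mod_cast f.conductor_pos
  unfold analyticConductor
  nlinarith

theorem log_analyticConductor_pos : 0 < Real.log f.analyticConductor :=
  Real.log_pos (by linarith [f.three_le_analyticConductor])

theorem analyticConductor_dual : f.dual.analyticConductor = f.analyticConductor := by
  simp [analyticConductor, dual]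

theorem normalized_dual_neg (γ : ℝ) : f.dual.normalized (-γ) = -f.normalized γ := by
  simp only [normalized, analyticConductor_dual]
  ring

/-- Turns a zero near `-α` into a zero of the dual near `α`. -/
theorem neg_mem_ordinates_dual {γ : ℝ} (hγ : γ ∈ f.ordinates) : -γ ∈ f.dual.ordinates := by
  have h : f.completed (1 / 2 + Complex.I * γ) = 0 := hγ
  show conj (f.completed (conj (1 / 2 + Complex.I * ((-γ : ℝ) : ℂ)))) = 0
  have e : conj (1 / 2 + Complex.I * ((-γ : ℝ) : ℂ)) = 1 / 2 + Complex.I * γ := by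
    simp [Complex.conj_ofNat]
  rw [e, h, map_zero]

theorem toFun_ne_zero : f.toFun ≠ 0 := by
  intro h
  have h0 : LSeries f.coeff = 0 := by
    funext s
    by_cases hs : LSeriesSummable f.coeff s
    · rw [← f.toFun_eq s hs, h]
    -- Where the series does not converge absolutely, `LSeries` is 0 by default, so it vanishes
    -- everywhere and uniqueness of Dirichlet coefficients applies.
    · exact LSeries.eq_zero_of_not_LSeriesSummable _ _ hs
  rcases (LSeries_eq_zero_iff f.coeff_zero).1 h0 with h1 | h1
  · obtain ⟨n, hn⟩ := f.coeff_ne_zero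
    exact hn (congrFun h1 n)
  · obtain ⟨s, hs⟩ := f.exists_summable
    have := hs.abscissaOfAbsConv_le
    rw [h1] at this
    exact absurd (top_le_iff.1 this) (EReal.coe_ne_top _)

/-- The archimedean factor has no zero on the critical line, so `L` would vanish along it and thus
identically. -/
theorem completed_ne_zero
    (harch : ∀ s : ℂ, s.re = 1 / 2 → archFactor f.conductor f.kappa s ≠ 0) :
    f.completed ≠ 0 := by
  intro h
  apply f.toFun_ne_zero
  have hFa : AnalyticOnNhd ℂ f.toFun Set.univ := fun z _ => f.differentiable_toFun.analyticAt z
  have h0a : AnalyticOnNhd ℂ (0 : ℂ → ℂ) Set.univ := fun z _ => analyticAt_const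
  refine hFa.eq_of_frequently_eq (z₀ := 1 / 2 + Complex.I * ((0 : ℝ) : ℂ)) h0a ?_
  have ht : Tendsto (fun x : ℝ => 1 / 2 + Complex.I * (x : ℂ)) (𝓝[≠] 0)
      (𝓝[≠] (1 / 2 + Complex.I * ((0 : ℝ) : ℂ))) :=
    (Continuous.tendsto (f := fun x : ℝ => 1 / 2 + Complex.I * (x : ℂ)) (by fun_prop) 0).inf
      (tendsto_principal_principal.2 fun x hx => by simpa using hx)
  refine ht.frequently (Eventually.frequently (Eventually.of_forall fun x => ?_))
  have ha := harch (1 / 2 + Complex.I * (x : ℂ)) (by simp)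
  have h1 := f.completed_eq _ ha
  rw [h] at h1
  exact (mul_eq_zero.1 h1.symm).resolve_left ha

theorem finite_ordinates_inter
    (harch : ∀ s : ℂ, s.re = 1 / 2 → archFactor f.conductor f.kappa s ≠ 0) (R : ℝ) :
    (f.ordinates ∩ Set.Icc (-R) R).Finite := by
  by_contra hinf
  obtain ⟨γ, -, hγ⟩ := Set.Infinite.exists_accPt_of_subset_isCompact hinf isCompact_Icc
    Set.inter_subset_right
  apply f.completed_ne_zero harch
  have hFa : AnalyticOnNhd ℂ f.completed Set.univ :=
    fun z _ => f.differentiable_completed.analyticAt z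
  have h0a : AnalyticOnNhd ℂ (0 : ℂ → ℂ) Set.univ := fun z _ => analyticAt_const
  refine hFa.eq_of_frequently_eq (z₀ := 1 / 2 + Complex.I * (γ : ℂ)) h0a ?_
  have ht : Tendsto (fun x : ℝ => 1 / 2 + Complex.I * (x : ℂ)) (𝓝[≠] γ)
      (𝓝[≠] (1 / 2 + Complex.I * (γ : ℂ))) :=
    (Continuous.tendsto (f := fun x : ℝ => 1 / 2 + Complex.I * (x : ℂ)) (by fun_prop) γ).inf
      (tendsto_principal_principal.2 fun x hx => by simpa using hx)
  refine ht.frequently ?_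
  rw [accPt_iff_frequently] at hγ
  rw [frequently_nhdsWithin_iff]
  exact hγ.mono fun x hx => ⟨hx.2.1, hx.1⟩

end LFunction

/-! ### Zeros in the family -/

variable {ι : Type*} {L : ι → LFunction} {o : ConductorOrdering}

theorem mem_familyAt_of_analyticConductor_eq {f g : ι} {Q : ℝ}
    (h : (L g).analyticConductor = (L f).analyticConductor) (hf : f ∈ familyAt L o Q) :
    g ∈ familyAt L o Q := by
  cases o
  · exact h.trans hf
  · exact h.le.trans hf

/-- Only distances up to a given one `d₀` compete. They come from finitely many `f` and bounded
windows of ordinates, each containing finitely many zeros. -/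
theorem exists_isLeast_zeroDistances (hL : IsAdmissibleFamily L)
    (hfin : ∀ Q, (familyAt L o Q).Finite) {α Q : ℝ} (hne : (zeroDistances L o α Q).Nonempty) :
    ∃ d, IsLeast (zeroDistances L o α Q) d := by
  obtain ⟨d₀, hd₀⟩ := hne
  have hS : (zeroDistances L o α Q ∩ Set.Iic d₀).Finite := by
    have hbig : (⋃ f ∈ familyAt L o Q, (fun γ => |(L f).normalized γ - α|) ''
        ((L f).ordinates ∩ Set.Icc
          (-((d₀ + |α|) * (2 * Real.pi) / Real.log (L f).analyticConductor))
          ((d₀ + |α|) * (2 * Real.pi) / Real.log (L f).analyticConductor))).Finite :=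
      (hfin Q).biUnion fun f _ =>
        ((L f).finite_ordinates_inter (hL.archFactor_ne_zero f) _).image _
    refine hbig.subset ?_
    rintro d ⟨⟨f, hf, γ, hγ, rfl⟩, hd⟩
    refine Set.mem_biUnion hf ⟨γ, ⟨hγ, ?_⟩, rfl⟩
    rw [Set.mem_Icc, ← abs_le, le_div_iff₀ (L f).log_analyticConductor_pos]
    have h1 : |(L f).normalized γ| ≤ d₀ + |α| := by
      have h2 := abs_sub_abs_le_abs_sub ((L f).normalized γ) α
      have h3 : |(L f).normalized γ - α| ≤ d₀ := hd
      linarith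
    rw [LFunction.normalized, abs_div, abs_of_pos (show 0 < 2 * Real.pi by positivity),
      div_le_iff₀ (by positivity), abs_mul, abs_of_pos (L f).log_analyticConductor_pos] at h1
    exact h1
  obtain ⟨d, hd, hmin⟩ := Set.exists_min_image _ _root_.id hS ⟨d₀, hd₀, le_refl d₀⟩
  refine ⟨d, hd.1, fun e he => ?_⟩
  rcases le_total e d₀ with h | h
  · exact hmin e ⟨he, h⟩
  · exact le_trans hd.2 h

/-- If `∫ |(x - α) F|² W_G < s² ∫ |F|² W_G`, eventually some zero lies within `s` of `α`. -/
theorem eventually_exists_zeroDistance_lt (hL : IsAdmissibleFamily L) {G : SymmetryGroup} {Δ : ℝ}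
    (hΔ : 0 < Δ) (hdensity : HasOneLevelDensity L o G Δ) {α s : ℝ} (hs : 0 ≤ s)
    {F : ℂ → ℂ} (hF : Differentiable ℂ F) (hexp : HasExpType F (Real.pi * Δ))
    (hL2 : MemLp (fun x : ℝ => F x) 2 volume)
    (hlt : ∫⁻ x : ℝ, ‖((x : ℂ) - α) * F x‖ₑ ^ 2 ∂G.density <
      ENNReal.ofReal (s ^ 2) * ∫⁻ x : ℝ, ‖F x‖ₑ ^ 2 ∂G.density) :
    ∀ᶠ Q in conductorFilter L o, ∃ d ∈ zeroDistances L o α Q, d < s := by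
  obtain ⟨φ, heven, hsupp, hneg, hφ⟩ := exists_test_function G hΔ hs hF hexp hL2 hlt
  filter_upwards [(hdensity φ heven hsupp).2.eventually_lt_const hneg] with Q hQ
  by_contra! hcon
  -- If every distance were at least `s`, `φ` would be non-negative at every normalized zero, and so
  -- would the average.
  refine absurd hQ (not_lt.2 (div_nonneg ?_ (Nat.cast_nonneg _)))
  refine finsum_nonneg fun f => finsum_nonneg fun hf => tsum_nonneg fun γ => mul_nonneg (Nat.cast_nonneg _) ?_
  by_contra! hlt0
  rcases hφ _ hlt0 with h | h
  · exact absurd h (not_lt.2 (hcon _ ⟨f, hf, γ, γ.2, rfl⟩))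
  -- The dual has the same conductor, hence lies in the same `𝓕(Q)`.
  · obtain ⟨g, hg⟩ := hL.dual_mem f
    refine absurd h (not_lt.2 (hcon _ ⟨g, mem_familyAt_of_analyticConductor_eq ?_ hf, -γ, ?_, ?_⟩))
    · rw [hg, LFunction.analyticConductor_dual]
    · rw [hg]
      exact (L f).neg_mem_ordinates_dual γ.2
    · rw [hg, LFunction.normalized_dual_neg]

/-- The dilated mollifier has a finite quotient, so taking `s² = n` above it produces a zero. -/
theorem eventually_zeroDistances_nonempty (hL : IsAdmissibleFamily L) {G : SymmetryGroup} {Δ : ℝ}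
    (hΔ : 0 < Δ) (hdensity : HasOneLevelDensity L o G Δ) (α : ℝ) :
    ∀ᶠ Q in conductorFilter L o, (zeroDistances L o α Q).Nonempty := by
  obtain ⟨η, hηd, hηe, hη0, -, hηr⟩ := exists_rapidly_decaying_entire
  set F : ℂ → ℂ := fun z => η ((Δ / 2 : ℝ) * z) with hFdef
  have hF : Differentiable ℂ F := hηd.comp (by fun_prop)
  have hFe : HasExpType F (Real.pi * Δ) :=
    (hηe.comp_mul (half_pos hΔ)).mono (le_of_eq (by ring))
  have hFr : HasRapidDecay fun x : ℝ => F x := by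
    have := hηr.comp_mul (half_pos hΔ)
    simpa only [Complex.ofReal_mul] using this
  have hFc : Continuous fun x : ℝ => F x := hF.continuous.comp Complex.continuous_ofReal
  have hL2 : ∀ g : ℝ → ℂ, Continuous g → HasRapidDecay g →
      Integrable fun x => ‖g x‖ ^ 2 := by
    intro g hgc hgr
    obtain ⟨C, hC⟩ := hgr 0
    simp only [pow_zero, one_mul] at hC
    simp only [sq]
    exact (hgr.integrable hgc).norm.bdd_mul (c := C) hgc.norm.aestronglyMeasurable
      (Eventually.of_forall fun x => by simpa using hC x)
  have hfinite : ∀ g : ℝ → ℂ, Continuous g → HasRapidDecay g →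
      ∫⁻ x, ‖g x‖ₑ ^ 2 ∂G.density ≠ ⊤ := by
    intro g hgc hgr
    have h1 := (G.integrable_density (hL2 g hgc hgr)).2
    rw [hasFiniteIntegral_iff_ofReal (Eventually.of_forall fun x => sq_nonneg _)] at h1
    refine ne_of_lt (lt_of_eq_of_lt (lintegral_congr fun x => ?_) h1)
    rw [← ofReal_norm, ← ENNReal.ofReal_pow (norm_nonneg _)]
  have hnum := hfinite (fun x : ℝ => ((x : ℂ) - α) * F x)
    ((by fun_prop : Continuous fun x : ℝ => (x : ℂ) - α).mul hFc)
    (hFr.mul_of_linear_growth (M := 1 + |α|) fun x => by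
      rw [← Complex.ofReal_sub, Complex.norm_real, Real.norm_eq_abs]
      refine (abs_sub x α).trans ?_
      nlinarith [abs_nonneg x, abs_nonneg α, mul_nonneg (abs_nonneg α) (abs_nonneg x)])
  have hden0 := G.lintegral_density_ne_zero hF (by
    intro h
    have := congrFun h 0
    simp [hFdef, hη0] at this)
  have hden := hfinite (fun x : ℝ => F x) hFc hFr
  set N := ∫⁻ x : ℝ, ‖((x : ℂ) - α) * F x‖ₑ ^ 2 ∂G.density
  set D := ∫⁻ x : ℝ, ‖F x‖ₑ ^ 2 ∂G.density
  obtain ⟨n, hn⟩ := ENNReal.exists_nat_gt (ENNReal.div_ne_top hnum hden0)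
  rw [ENNReal.div_lt_iff (Or.inl hden0) (Or.inl hden)] at hn
  have hlt : N < ENNReal.ofReal ((Real.sqrt n) ^ 2) * D := by
    rwa [Real.sq_sqrt (Nat.cast_nonneg _), ENNReal.ofReal_natCast]
  filter_upwards [eventually_exists_zeroDistance_lt hL hΔ hdensity (Real.sqrt_nonneg _) hF hFe
    ((memLp_two_iff_integrable_sq_norm hFc.aestronglyMeasurable).2 (hL2 _ hFc hFr)) hlt] with Q hQ
  obtain ⟨d, hd, -⟩ := hQ
  exact ⟨d, hd⟩

end

/-! ### Passage to the infimum -/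

/-- The minimum over`𝓕(Q)` exists for all large `Q`, and its limsup as `Q → ∞` is at most
`√𝔸(G, πΔ, α)`. -/
theorem theorem1 {ι : Type*} (L : ι → LFunction) (hL : IsAdmissibleFamily L)
    (o : ConductorOrdering) (hfin : ∀ Q, (familyAt L o Q).Finite)
    (hGRH : ∀ f, (L f).GRH)
    (G : SymmetryGroup) (Δ : ℝ) (hΔ : 0 < Δ) (hdensity : HasOneLevelDensity L o G Δ)
    (α : ℝ) (hα : α ≠ 0) :
    (∀ᶠ Q in conductorFilter L o, ∃ d, IsLeast (zeroDistances L o α Q) d) ∧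
    limsup (fun Q => ⨅ d ∈ zeroDistances L o α Q, ENNReal.ofReal d) (conductorFilter L o) ≤
      (sharpConstant G (Real.pi * Δ) α) ^ (1 / 2 : ℝ) := by
  refine ⟨(eventually_zeroDistances_nonempty hL hΔ hdensity α).mono fun Q hQ =>
    exists_isLeast_zeroDistances hL hfin hQ, ?_⟩
  refine le_of_forall_gt fun c hc => ?_
  obtain ⟨b, hb, hbc⟩ := exists_between hc
  refine lt_of_le_of_lt ?_ hbc
  have hbtop : b ≠ ⊤ := ne_top_of_lt hbc
  -- The number `b`, strictly above `√𝔸`, plays the role of `s`; strictness yields an `F` with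
  -- quotient below `b²`.
  have hsharp : sharpConstant G (Real.pi * Δ) α < ENNReal.ofReal (b.toReal ^ 2) := by
    rw [ENNReal.ofReal_pow ENNReal.toReal_nonneg, ENNReal.ofReal_toReal hbtop]
    rw [one_div, ENNReal.rpow_inv_lt_iff (by norm_num)] at hb
    exact_mod_cast hb
  rw [sharpConstant] at hsharp
  simp only [iInf_lt_iff] at hsharp
  obtain ⟨F, ⟨⟨hF, hFe, hL2⟩, hF0⟩, hlt⟩ := hsharp
  have hFc : Continuous fun x : ℝ => F x := hF.continuous.comp Complex.continuous_ofReal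
  have hden : ∫⁻ x : ℝ, ‖F x‖ₑ ^ 2 ∂G.density ≠ ⊤ := by
    have h1 := (G.integrable_density (hL2.integrable_norm_pow (p := 2) (by norm_num))).2
    rw [hasFiniteIntegral_iff_ofReal (Eventually.of_forall fun x => sq_nonneg _)] at h1
    refine ne_of_lt (lt_of_eq_of_lt (lintegral_congr fun x => ?_) h1)
    rw [← ofReal_norm, ← ENNReal.ofReal_pow (norm_nonneg _)]
  rw [ENNReal.div_lt_iff (Or.inl (G.lintegral_density_ne_zero hF hF0)) (Or.inl hden)] at hlt
  have hev := eventually_exists_zeroDistance_lt hL hΔ hdensity ENNReal.toReal_nonneg hF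
    (hasExpType_of_exponentialType_le hF.continuous hFe) hL2 hlt
  refine limsup_le_of_le (by isBoundedDefault) (hev.mono fun Q hQ => ?_)
  obtain ⟨d, hd, hdb⟩ := hQ
  exact (iInf₂_le d hd).trans (ENNReal.ofReal_le_of_le_toReal hdb.le)
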